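/- Conventions. A two-dimensional complex torus is a quotient $X=\mathbb{C}^2/\Lambda$ with $\Lambda$ a lattice (a discrete subgroup spanning $\mathbb{C}^2$ over $\mathbb{R}$); an automorphism of $X$ is a biholomorphic self-map (not necessarily a group homomorphism), and its entropy is its topological entropy. An isogeny $X_1\to X_2$ is a surjective holomorphic group homomorphism with finite kernel; the isogeny class of $X$ is the set of tori to which $X$ has an isogeny. A Salem polynomial is an irreducible, monic, reciprocal polynomial in $\mathbb{Z}[t]$ with exactly two complex roots of absolute value $\neq 1$ (degree two is allowed), and a Salem number is a real number $\lambda>1$ that is the largest real root of a Salem polynomial. Statement. (0) The tori $\mathbb{C}/\mathbb{Z}[2^k i]\times\mathbb{C}/\mathbb{Z}[2^k i]$, $k\ge 0$, are all isogenous to one another. Let $\lambda$ be a Salem number such that $\log\lambda$ is the entropy of some automorphism of a two-dimensional complex torus. Suppose that the set of isomorphism classes of two-dimensional complex tori admitting an automorphism of entropy $\log\lambda$ is finite, or that neither $\lambda+\lambda^{-1}+2$ nor $\lambda+\lambda^{-1}-2$ is the square of an integer. Then: (1) The two-dimensional complex tori admitting an automorphism of entropy $\log\lambda$ represent at most $320$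 isogeny classes. (2) Let $\mathcal{P}_\lambda$ be the set of pairs $\{\gamma_1,\gamma_2\}$ of Galois conjugate algebraic integers of degree four with $|\gamma_1|>|\gamma_2|$ and $|\gamma_1\gamma_2|=1$ such that the six products of two of $\gamma_1,\gamma_2,\overline{\gamma_1},\overline{\gamma_2}$ are, with multiplicity, the roots of a monic reciprocal degree-six polynomial $Q(t)\in\mathbb{Z}[t]$ that is divisible by the minimal polynomial of $\lambda$, has exactly four roots (with multiplicity) on the unit circle, and satisfies $Q(1)=-m^2$ and $Q(-1)=n^2$ for some integers $m,n$. The number of isogeny classes in (1) is at most $|\mathcal{P}_\lambda|$, and $|\mathcal{P}_\lambda|\le 320$. (3) Let $G=\mathrm{diag}(\gamma_1,\gamma_2)$ with $\gamma_1,\gamma_2\in\mathbb{C}$ and $|\gamma_1|^2=\lambda$, and let $\Lambda_1,\Lambda_2\subset\mathbb{C}^2$ be lattices with $G(\Lambda_1)=\Lambda_1$ and $G(\Lambda_2)=\Lambda_2$. Then $G|_{\Lambda_1}$ and $G|_{\Lambda_2}$ are conjugate over $\mathbb{Q}$: there is a $\mathbb{Q}$-linear isomorphism $\Lambda_1\otimes\mathbb{Q}\to\Lambda_2\otimes\mathbb{Q}$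 that commutes with $G$. Moreover there is a matrix $\Phi\in\mathrm{GL}_2(\mathbb{C})$ with $\Phi G=G\Phi$ and $\Phi(\Lambda_1\otimes\mathbb{Q})=\Lambda_2\otimes\mathbb{Q}$ (rational spans in $\mathbb{C}^2$), and some nonzero integer multiple of $\Phi$ induces an isogeny $\mathbb{C}^2/\Lambda_1\to\mathbb{C}^2/\Lambda_2$. -/

import Mathlib

open scoped Polynomial

/-- A two-dimensional complex torus `ℂ² / Λ`, given by its lattice `Λ`: a discrete subgroup of
`ℂ²` that spans `ℂ²` over `ℝ`. -/
structure ComplexTorus where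
  /-- the lattice `Λ` -/
  lattice : Submodule ℤ (Fin 2 → ℂ)
  discrete : DiscreteTopology lattice
  span_eq_top : Submodule.span ℝ (lattice : Set (Fin 2 → ℂ)) = ⊤

namespace ComplexTorus

/-- The underlying compact abelian group `ℂ² / Λ`, with its quotient topology and its uniform
structure as a topological group (both come from the instances on quotients in Mathlib). -/
abbrev Carrier (X : ComplexTorus) : Type := (Fin 2 → ℂ) ⧸ X.lattice

/-- The quotient map `ℂ² → ℂ² / Λ`. -/
def proj (X : ComplexTorus) (z : Fin 2 → ℂ) : X.Carrier := X.lattice.mkQ z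

/-- A map of complex tori is holomorphic if, near each point of `ℂ²`, it lifts to a holomorphic
map with values in `ℂ²`. As the quotient maps are local biholomorphisms, this is holomorphy for the
quotient complex structures. -/
def IsHolomorphic {X Y : ComplexTorus} (f : X.Carrier → Y.Carrier) : Prop :=
  ∀ z : Fin 2 → ℂ, ∃ U : Set (Fin 2 → ℂ), IsOpen U ∧ z ∈ U ∧
    ∃ g : (Fin 2 → ℂ) → (Fin 2 → ℂ), DifferentiableOn ℂ g U ∧
      ∀ w ∈ U, f (X.proj w) = Y.proj (g w)

/-- Biholomorphic maps of complex tori (not assumed to respect the group structures). -/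
def IsBiholomorphic {X Y : ComplexTorus} (f : X.Carrier ≃ Y.Carrier) : Prop :=
  IsHolomorphic (f : X.Carrier → Y.Carrier) ∧ IsHolomorphic (f.symm : Y.Carrier → X.Carrier)

/-- `X` admits a (biholomorphic) automorphism whose topological entropy is `h`. -/
def AdmitsEntropy (X : ComplexTorus) (h : ℝ) : Prop :=
  ∃ f : X.Carrier ≃ X.Carrier, IsBiholomorphic f ∧
    Dynamics.coverEntropy (f : X.Carrier → X.Carrier) Set.univ = (h : EReal)

/-- The isomorphism (that is, biholomorphism) class of a complex torus. -/
def isomorphismClass (X : ComplexTorus) : Set ComplexTorus :=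
  {Y | ∃ f : X.Carrier ≃ Y.Carrier, IsBiholomorphic f}

/-- An isogeny: a surjective holomorphic group homomorphism with finite kernel. -/
def IsIsogeny {X Y : ComplexTorus} (f : X.Carrier →+ Y.Carrier) : Prop :=
  IsHolomorphic (f : X.Carrier → Y.Carrier) ∧ Function.Surjective f ∧ Finite f.ker

/-- There is an isogeny from `X` to `Y`. -/
def Isogenous (X Y : ComplexTorus) : Prop :=
  ∃ f : X.Carrier →+ Y.Carrier, IsIsogeny f

/-- The isogeny class of a complex torus. -/
def isogenyClass (X : ComplexTorus) : Set ComplexTorus :=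
  {Y | Isogenous X Y}

/-- `Λ ⊗ ℚ`, realized inside `ℂ²` as the rational span of `Λ`. -/
noncomputable def rationalSpan (X : ComplexTorus) : Submodule ℚ (Fin 2 → ℂ) :=
  Submodule.span ℚ (X.lattice : Set (Fin 2 → ℂ))

/-- The torus whose lattice has a given real basis of `ℂ²` as its integral basis. -/
noncomputable def ofBasis {ι : Type} [Finite ι] (b : Module.Basis ι ℝ (Fin 2 → ℂ)) : ComplexTorus where
  lattice := Submodule.span ℤ (Set.range b)
  discrete := inferInstance
  span_eq_top := ZSpan.span_top b

/-- The real basis of `ℂ²` formed by `1` and `2 ^ k * i` in each of the two coordinates. -/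
noncomputable def gaussianBasis (k : ℕ) : Module.Basis (Σ _ : Fin 2, Fin 2) ℝ (Fin 2 → ℂ) :=
  Pi.basis fun _ => Complex.basisOneI.isUnitSMul (w := ![1, 2 ^ k])
    (by intro i; fin_cases i <;> simp)

/-- The torus `ℂ / ℤ[2 ^ k * i] × ℂ / ℤ[2 ^ k * i]`. -/
noncomputable def gaussianSquare (k : ℕ) : ComplexTorus := ofBasis (gaussianBasis k)

end ComplexTorus

/-- A Salem polynomial: irreducible, monic and reciprocal over `ℤ`, with exactly two complex roots
of absolute value different from one. (Degree two is allowed.) -/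
def IsSalemPolynomial (S : ℤ[X]) : Prop :=
  Irreducible S ∧ S.Monic ∧ S.reverse = S ∧ {z : ℂ | Polynomial.aeval z S = 0 ∧ ‖z‖ ≠ 1}.ncard = 2

/-- A Salem number: a real number greater than one that is the largest real root of a Salem
polynomial. -/
def IsSalemNumber (lam : ℝ) : Prop :=
  1 < lam ∧ ∃ S : ℤ[X], IsSalemPolynomial S ∧ IsGreatest {x : ℝ | Polynomial.aeval x S = 0} lam

/-- The pairs of Galois conjugate algebraic integers `γ₁`, `γ₂` of degree four with `|γ₁| > |γ₂|`
and `|γ₁ γ₂| = 1` such that the six products of two of `γ₁, γ₂, γ̄₁, γ̄₂` are the roots of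
a monic reciprocal integer polynomial `Q` of degree six which is divisible by the minimal polynomial
of `lam`, has four roots on the unit circle, and satisfies `Q(1) = -m²` and `Q(-1) = n²` for some
integers `m` and `n`. The condition `|γ₁| > |γ₂|` orders each pair. -/
def eigenvaluePairs (lam : ℝ) : Set (ℂ × ℂ) :=
  {γ | IsIntegral ℤ γ.1 ∧ (minpoly ℚ γ.1).natDegree = 4 ∧ minpoly ℚ γ.2 = minpoly ℚ γ.1 ∧
    ‖γ.2‖ < ‖γ.1‖ ∧ ‖γ.1 * γ.2‖ = 1 ∧
    ∃ Q : ℤ[X], Q.Monic ∧ Q.natDegree = 6 ∧ Q.reverse = Q ∧ minpoly ℤ lam ∣ Q ∧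
      (Q.map (Int.castRingHom ℂ)).roots =
        {γ.1 * γ.2, γ.1 * star γ.1, γ.1 * star γ.2,
          γ.2 * star γ.1, γ.2 * star γ.2, star γ.1 * star γ.2} ∧
      (Multiset.map (fun z : ℂ => ‖z‖) (Q.map (Int.castRingHom ℂ)).roots).count 1 = 4 ∧
      ∃ m n : ℤ, Q.eval 1 = -m ^ 2 ∧ Q.eval (-1) = n ^ 2}

/-! An automorphism lifts to an affine map z ↦ Az + b of ℂ² (`IsHolomorphic.exists_affine`), and A
restricts to an automorphism of Λ. Its eigenvalues therefore satisfy |γ₁γ₂| = 1, and if |γ₁| ≥ |γ₂|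
the entropy is log |γ₁|² (`coverEntropy_eq`). So entropy log λ means |γ₁|² = λ, and the
characteristic polynomial P of A on Λ is an integral quartic with roots γ₁, γ̄₁, γ₂, γ̄₂.

Everything turns on the irreducibility of P. A linear factor would have root ±1, which has the wrong
absolute value. A quadratic factor has constant term ±1, and then λ + λ⁻¹ + 2 or λ + λ⁻¹ − 2 is the
square of its middle coefficient (`Polynomial.Monic.irreducible_of_quartic`). Conversely, such a
square gives an integral 2 × 2 matrix with eigenvalue √λ and determinant ±1. This matrix acts on E ×
E for every E = ℂ/ℤ[2^k i], producing infinitely many tori (`infinite_isomorphismClass`). Hence each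
of the two alternative hypotheses yields irreducibility.

When P is irreducible, Λ ⊗ ℚ is one-dimensional over ℚ[t]/P. In eigencoordinates it is spanned by
the vectors (γ₁ⁱ v₀, γ₂ⁱ v₁), so two lattices with the same ordered pair (γ₁, γ₂) have rational
spans that differ by a diagonal matrix (`exists_diagonal_rationalSpan`). This gives the conjugacy
and the commuting isogeny, and it shows that the isogeny class depends only on the pair.

To count pairs, put u = t + t⁻¹ and s = λ + λ⁻¹. The sextic Q of the exterior square becomes (u −
s)(u² − pu + q), where the quadratic has both roots in [−2, 2]. Integrality leaves at most 20 pairs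
(p, q) (`encard_circlePairs_le`), and (p, q) determines (γ₁, γ₂) up to four signs
(`encard_eigenvaluePairs_le`), so there are at most 20 · 16 = 320. -/

namespace ComplexTorus

/-! ### Lattices, and the affine form of holomorphic maps of tori. -/

variable (X Y Z : ComplexTorus)

instance : DiscreteTopology X.lattice := X.discrete

instance : IsZLattice ℝ X.lattice := ⟨X.span_eq_top⟩

instance : Module.Free ℤ X.lattice := ZLattice.module_free ℝ X.lattice

instance : Module.Finite ℤ X.lattice := ZLattice.module_finite ℝ X.lattice

theorem finrank_lattice : Module.finrank ℤ X.lattice = 4 := by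
  rw [ZLattice.rank ℝ X.lattice, Module.finrank_pi_fintype]
  simp [Complex.finrank_real_complex]

/-- An integral basis of the lattice. -/
noncomputable def latticeBasis : Module.Basis (Fin 4) ℤ X.lattice :=
  (Module.finBasis ℤ X.lattice).reindex (finCongr X.finrank_lattice)

/-- An integral basis of the lattice, as a real basis of the ambient space. -/
noncomputable def realBasis : Module.Basis (Fin 4) ℝ (Fin 2 → ℂ) :=
  X.latticeBasis.ofZLatticeBasis ℝ X.lattice

theorem realBasis_apply (i : Fin 4) : X.realBasis i = X.latticeBasis i :=
  X.latticeBasis.ofZLatticeBasis_apply ℝ X.lattice i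

theorem span_realBasis : Submodule.span ℤ (Set.range X.realBasis) = X.lattice :=
  X.latticeBasis.ofZLatticeBasis_span ℝ X.lattice

variable {X Y Z}

@[simp]
theorem proj_add (z w : Fin 2 → ℂ) : X.proj (z + w) = X.proj z + X.proj w := map_add _ _ _

theorem proj_eq_zero {z : Fin 2 → ℂ} : X.proj z = 0 ↔ z ∈ X.lattice :=
  Submodule.Quotient.mk_eq_zero _

theorem proj_eq_proj {z w : Fin 2 → ℂ} : X.proj z = X.proj w ↔ z - w ∈ X.lattice :=
  Submodule.Quotient.eq _

theorem proj_surjective : Function.Surjective X.proj := Submodule.mkQ_surjective _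

theorem isCoveringMap_proj : IsCoveringMap X.proj :=
  (AddSubgroup.isAddQuotientCoveringMap_of_comm X.lattice.toAddSubgroup
    (show IsDiscrete (X.lattice : Set (Fin 2 → ℂ)) from ⟨X.discrete⟩)).isCoveringMap

theorem continuous_proj : Continuous X.proj := isCoveringMap_proj.continuous

/-- A nonzero lattice vector has norm bounded below. -/
theorem exists_norm_lt_eq_zero (X : ComplexTorus) :
    ∃ ε > 0, ∀ l ∈ X.lattice, ‖l‖ < ε → l = 0 := by
  obtain ⟨ε, hε, h⟩ := Metric.exists_ball_inter_eq_singleton_of_mem_discrete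
    (s := (X.lattice : Set (Fin 2 → ℂ))) ⟨X.discrete⟩ X.lattice.zero_mem
  refine ⟨ε, hε, fun l hl hlt => ?_⟩
  have : l ∈ Metric.ball (0 : Fin 2 → ℂ) ε ∩ X.lattice := ⟨by simpa using hlt, hl⟩
  rw [h] at this
  simpa using this

/-- A compact set meeting every class modulo the lattice. -/
theorem exists_bound_rep (X : ComplexTorus) :
    ∃ R > 0, ∀ z : Fin 2 → ℂ, ∃ w, ‖w‖ ≤ R ∧ z - w ∈ X.lattice := by
  refine ⟨(∑ i, ‖X.realBasis i‖) + 1, by positivity, fun z =>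
    ⟨ZSpan.fract X.realBasis z, (ZSpan.norm_fract_le X.realBasis z).trans (by simp), ?_⟩⟩
  rw [ZSpan.fract_apply, sub_sub_cancel]
  exact X.span_realBasis.le (ZSpan.floor X.realBasis z).2

theorem IsHolomorphic.continuous {f : X.Carrier → Y.Carrier} (hf : IsHolomorphic f) :
    Continuous f := by
  rw [isCoveringMap_proj.isQuotientMap proj_surjective |>.continuous_iff]
  rw [continuous_iff_continuousAt]
  intro z
  obtain ⟨U, hU, hz, g, hg, h⟩ := hf z
  have : ContinuousAt (fun w => Y.proj (g w)) z :=
    continuous_proj.continuousAt.comp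
      (hg.differentiableAt (hU.mem_nhds hz)).continuousAt
  exact this.congr (Filter.eventually_of_mem (hU.mem_nhds hz) fun w hw => (h w hw).symm)

/-- A continuous function with values in a lattice is constant. -/
theorem continuous_lattice_const {g : (Fin 2 → ℂ) → (Fin 2 → ℂ)} (hg : Continuous g)
    (h : ∀ z, g z ∈ Y.lattice) (z w : Fin 2 → ℂ) : g z = g w := by
  have hc : Continuous fun z => (⟨g z, h z⟩ : Y.lattice) := hg.subtype_mk _
  exact congrArg Subtype.val (PreconnectedSpace.constant inferInstance hc (x := z) (y := w))

/-- A holomorphic map of tori lifts to an entire map. -/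
theorem IsHolomorphic.exists_lift {f : X.Carrier → Y.Carrier} (hf : IsHolomorphic f) :
    ∃ F : (Fin 2 → ℂ) → (Fin 2 → ℂ), Differentiable ℂ F ∧ ∀ z, f (X.proj z) = Y.proj (F z) := by
  obtain ⟨e, he⟩ := Y.proj_surjective (f (X.proj 0))
  obtain ⟨F, ⟨-, hF⟩, -⟩ := isCoveringMap_proj.existsUnique_continuousMap_lifts
    (⟨f ∘ X.proj, hf.continuous.comp continuous_proj⟩ : C(Fin 2 → ℂ, Y.Carrier)) 0 e he
  have hF' : ∀ z, Y.proj (F z) = f (X.proj z) := fun z => congrFun hF z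
  refine ⟨F, fun z => ?_, fun z => (hF' z).symm⟩
  -- F and the local holomorphic lift g differ by lattice vectors. Continuity and discreteness make
  -- the difference constant near z, so F inherits differentiability from g.
  obtain ⟨U, hU, hz, g, hg, h⟩ := hf z
  obtain ⟨ε, hε, hε'⟩ := Y.exists_norm_lt_eq_zero
  have hgz := hg.differentiableAt (hU.mem_nhds hz)
  have hcont : ContinuousAt (fun w => (F w - g w) - (F z - g z)) z :=
    ((F.continuous.continuousAt).sub hgz.continuousAt).sub continuousAt_const
  have h1 : ∀ᶠ w in nhds z, ‖(F w - g w) - (F z - g z)‖ < ε := by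
    have := hcont.norm
    refine this.eventually_lt continuousAt_const ?_
    simpa using hε
  have h2 : ∀ w ∈ U, F w - g w ∈ Y.lattice := fun w hw => by
    rw [← proj_eq_proj, hF', h w hw]
  have h3 : (fun w => g w + (F z - g z)) =ᶠ[nhds z] F := by
    filter_upwards [h1, hU.mem_nhds hz] with w hw hwU
    have := hε' _ (Y.lattice.sub_mem (h2 w hwU) (h2 z hz)) hw
    rw [sub_eq_zero] at this
    rw [← this]; simp
  exact (hgz.add_const _).congr_of_eventuallyEq h3.symm

/-- A holomorphic map of tori is affine. -/
theorem IsHolomorphic.exists_affine {f : X.Carrier → Y.Carrier} (hf : IsHolomorphic f) :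
    ∃ (A : Matrix (Fin 2) (Fin 2) ℂ) (b : Fin 2 → ℂ),
      ∀ z, f (X.proj z) = Y.proj (A.mulVec z + b) := by
  obtain ⟨F, hF, hfF⟩ := hf.exists_lift
  -- For fixed l the increment F(z + l) − F(z) is continuous in z and lattice-valued, hence
  -- constant.
  have hper : ∀ l ∈ X.lattice, ∀ z w, F (z + l) - F z = F (w + l) - F w := by
    intro l hl z w
    refine continuous_lattice_const (Y := Y) (g := fun z => F (z + l) - F z)
      (by have := hF.continuous; fun_prop) (fun z => ?_) z w
    rw [← proj_eq_proj, ← hfF, ← hfF]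
    congr 1
    rw [proj_eq_proj]; simpa using hl
  obtain ⟨R, hR, hrep⟩ := X.exists_bound_rep
  -- By quasi-periodicity and compactness, F has bounded increments along w over unit discs.
  -- Cauchy's estimate bounds the derivative along the line, and Liouville makes it constant.
  have key : ∀ w, F w = F 0 + fderiv ℂ F 0 w := by
    intro w
    -- bound on increments
    obtain ⟨K, hK⟩ : ∃ K, ∀ z : Fin 2 → ℂ, ∀ ζ : ℂ, ‖ζ‖ ≤ 1 → ‖F (z + ζ • w) - F z‖ ≤ K := by
      have hc : IsCompact (Metric.closedBall (0 : Fin 2 → ℂ) R ×ˢ Metric.closedBall (0 : ℂ) 1) :=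
        (isCompact_closedBall _ _).prod (isCompact_closedBall _ _)
      obtain ⟨K, hK⟩ := hc.exists_bound_of_continuousOn
        (f := fun p : (Fin 2 → ℂ) × ℂ => F (p.1 + p.2 • w) - F p.1)
        (by have := hF.continuous; fun_prop)
      refine ⟨K, fun z ζ hζ => ?_⟩
      obtain ⟨y, hy, hl⟩ := hrep z
      have h1 := hper _ hl (y + ζ • w) y
      have h2 : F (z + ζ • w) - F z = F (y + ζ • w) - F y := by
        have e1 : y + ζ • w + (z - y) = z + ζ • w := by abel
        have e2 : y + (z - y) = z := by abel
        rw [e1, e2] at h1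
        have := sub_eq_sub_iff_sub_eq_sub.mp h1
        exact this
      rw [h2]
      exact hK (y, ζ) ⟨by simpa using hy, by simpa using hζ⟩
    let u : ℂ → (Fin 2 → ℂ) := fun t => F (t • w)
    have hu : Differentiable ℂ u := hF.comp (differentiable_id.smul_const w)
    have hbound : ∀ t, ‖deriv u t‖ ≤ K := by
      intro t
      have hd : deriv u t = deriv (fun s => u s - u t) t := by rw [deriv_sub_const]
      rw [hd]
      have := Complex.norm_deriv_le_of_forall_mem_sphere_norm_le (f := fun s => u s - u t)
        (c := t) (R := 1) (C := K) one_pos (hu.sub_const _).diffContOnCl ?_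
      · simpa using this
      · intro s hs
        have : u s - u t = F (t • w + (s - t) • w) - F (t • w) := by
          simp only [u, ← add_smul]; congr 3; ring
        rw [this]
        refine hK _ _ ?_
        rw [← dist_eq_norm]; exact (Metric.mem_sphere.mp hs).le
    have hdu : Differentiable ℂ (deriv u) := by
      rw [← differentiableOn_univ]
      exact hu.differentiableOn.deriv isOpen_univ
    have hconst : ∀ t, deriv u t = deriv u 0 := fun t =>
      hdu.apply_eq_apply_of_bounded
        ((Metric.isBounded_closedBall (x := (0 : Fin 2 → ℂ)) (r := K)).subset
          (by rintro _ ⟨s, rfl⟩; simpa using hbound s)) t 0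
    have hlin : ∀ t, u t - t • deriv u 0 = u 0 - (0 : ℂ) • deriv u 0 := by
      intro t
      refine is_const_of_deriv_eq_zero (𝕜 := ℂ) (f := fun t => u t - t • deriv u 0)
        (hu.sub (differentiable_id.smul_const _)) (fun s => ?_) t 0
      have h1 : HasDerivAt (fun t => u t - t • deriv u 0) (deriv u s - (1 : ℂ) • deriv u 0) s :=
        (hu s).hasDerivAt.sub ((hasDerivAt_id s).smul_const _)
      rw [h1.deriv, hconst s]; simp
    have h0 : deriv u 0 = fderiv ℂ F 0 w := by
      have h1 : HasDerivAt (fun t : ℂ => t • w) w 0 := by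
        simpa using (hasDerivAt_id (0 : ℂ)).smul_const w
      have h2 : HasFDerivAt F (fderiv ℂ F 0) ((0 : ℂ) • w) := by
        rw [zero_smul]; exact (hF 0).hasFDerivAt
      exact (h2.comp_hasDerivAt (0 : ℂ) h1).deriv
    have := hlin 1
    simp only [u, one_smul, zero_smul, sub_zero] at this
    rw [← h0, ← this]
    simp only [u]; abel
  refine ⟨LinearMap.toMatrix' (fderiv ℂ F 0).toLinearMap, F 0, fun z => ?_⟩
  rw [hfF, key z, LinearMap.toMatrix'_mulVec, add_comm]
  rfl

/-- The linear part of a lift of a map of tori preserves lattices. -/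
theorem mulVec_mem_lattice {f : X.Carrier → Y.Carrier} {A : Matrix (Fin 2) (Fin 2) ℂ}
    {b : Fin 2 → ℂ} (h : ∀ z, f (X.proj z) = Y.proj (A.mulVec z + b)) {l : Fin 2 → ℂ}
    (hl : l ∈ X.lattice) : A.mulVec l ∈ Y.lattice := by
  have h1 : X.proj l = X.proj 0 := by rw [proj_eq_proj]; simpa using hl
  have h2 := h l
  rw [h1, h 0, eq_comm, proj_eq_proj] at h2
  simpa using h2

/-- A biholomorphism of tori is affine, and its linear part is an isomorphism of lattices. -/
theorem IsBiholomorphic.exists_affine {f : X.Carrier ≃ Y.Carrier} (hf : IsBiholomorphic f) :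
    ∃ (A : Matrix (Fin 2) (Fin 2) ℂ) (b : Fin 2 → ℂ),
      (∀ z, f (X.proj z) = Y.proj (A.mulVec z + b)) ∧ IsUnit A ∧
      ∀ z, A.mulVec z ∈ Y.lattice ↔ z ∈ X.lattice := by
  obtain ⟨A, b, hA⟩ := hf.1.exists_affine
  obtain ⟨B, c, hB⟩ := hf.2.exists_affine
  -- The composite of the two lifts differs from the identity by a continuous lattice-valued map,
  -- hence by a constant. Comparing with the value at 0 removes the translations.
  have key : ∀ z, B.mulVec (A.mulVec z) = z := by
    intro z
    have h1 : ∀ w, B.mulVec (A.mulVec w + b) + c - w ∈ X.lattice := by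
      intro w
      rw [← proj_eq_proj, ← hB, ← hA, Equiv.symm_apply_apply]
    have := continuous_lattice_const (Y := X)
      (g := fun w => B.mulVec (A.mulVec w + b) + c - w)
      (by fun_prop) h1 z 0
    simp only [Matrix.mulVec_add, Matrix.mulVec_zero] at this
    have h2 : B.mulVec (A.mulVec z) - z = 0 := by
      linear_combination (exp := 1) this
    exact sub_eq_zero.mp h2
  have hBA : B * A = 1 := by
    apply Matrix.ext_of_mulVec_single
    intro i
    rw [← Matrix.mulVec_mulVec, key, Matrix.one_mulVec]
  refine ⟨A, b, hA, IsUnit.of_mul_eq_one_right B hBA, fun z => ⟨fun h => ?_, mulVec_mem_lattice hA⟩⟩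
  have := mulVec_mem_lattice hB h
  rwa [key] at this

end ComplexTorus

/-! ### Isogenies and rational spans. -/

namespace ComplexTorus

variable {X Y Z : ComplexTorus}

theorem lattice_le_rationalSpan {z : Fin 2 → ℂ} (hz : z ∈ X.lattice) : z ∈ X.rationalSpan :=
  Submodule.subset_span hz

/-- Every rational combination of lattice vectors has an integral multiple in the lattice. -/
theorem exists_zsmul_mem_lattice {z : Fin 2 → ℂ} (hz : z ∈ X.rationalSpan) :
    ∃ n : ℤ, n ≠ 0 ∧ n • z ∈ X.lattice := by
  induction hz using Submodule.span_induction with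
  | mem x hx => exact ⟨1, one_ne_zero, by simpa using hx⟩
  | zero => exact ⟨1, one_ne_zero, by simp⟩
  | add x y _ _ hx hy =>
    obtain ⟨m, hm, hx⟩ := hx
    obtain ⟨n, hn, hy⟩ := hy
    refine ⟨m * n, mul_ne_zero hm hn, ?_⟩
    rw [smul_add, mul_comm, mul_smul, mul_comm, mul_smul]
    exact X.lattice.add_mem (X.lattice.smul_mem _ hx) (X.lattice.smul_mem _ hy)
  | smul a x _ hx =>
    obtain ⟨m, hm, hx⟩ := hx
    refine ⟨a.den * m, mul_ne_zero (by exact_mod_cast a.den_nz) hm, ?_⟩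
    have : ((a.den : ℤ) * m) • a • x = a.num • m • x := by
      rw [mul_smul, smul_comm m a x]
      rw [← Int.cast_smul_eq_zsmul ℚ, ← Int.cast_smul_eq_zsmul ℚ a.num, smul_smul]
      congr 1
      rw [mul_comm]; push_cast; exact a.mul_den_eq_num
    rw [this]
    exact X.lattice.smul_mem _ hx

theorem mulVec_bijective {N : Matrix (Fin 2) (Fin 2) ℂ} (hN : IsUnit N) :
    Function.Bijective N.mulVec :=
  ⟨Matrix.mulVec_injective_iff_isUnit.mpr hN, Matrix.mulVec_surjective_iff_isUnit.mpr hN⟩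

/-- Multiplication by a matrix, as an additive endomorphism of `ℂ²`. -/
def mulVecInt (N : Matrix (Fin 2) (Fin 2) ℂ) : (Fin 2 → ℂ) →ₗ[ℤ] (Fin 2 → ℂ) :=
  N.mulVecLin.restrictScalars ℤ

@[simp]
theorem mulVecInt_apply (N : Matrix (Fin 2) (Fin 2) ℂ) (z : Fin 2 → ℂ) :
    mulVecInt N z = N.mulVec z := rfl

theorem isHolomorphic_of_affine {f : X.Carrier → Y.Carrier} {A : Matrix (Fin 2) (Fin 2) ℂ}
    {b : Fin 2 → ℂ} (h : ∀ z, f (X.proj z) = Y.proj (A.mulVec z + b)) : IsHolomorphic f :=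
  fun _ => ⟨Set.univ, isOpen_univ, Set.mem_univ _, fun z => A.mulVec z + b,
    Differentiable.differentiableOn
      ((A.mulVecLin.toContinuousLinearMap.differentiable).add_const b), fun w _ => h w⟩

/-- An invertible matrix mapping one lattice into another, and compatible with the rational spans,
induces an isogeny. -/
theorem exists_isIsogeny {N : Matrix (Fin 2) (Fin 2) ℂ} (hN : IsUnit N)
    (h : ∀ z ∈ X.lattice, N.mulVec z ∈ Y.lattice)
    (h' : ∀ z, N.mulVec z ∈ Y.lattice → z ∈ X.rationalSpan) :
    ∃ f : X.Carrier →+ Y.Carrier, IsIsogeny f ∧ ∀ z, f (X.proj z) = Y.proj (N.mulVec z) := by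
  let g : X.Carrier →ₗ[ℤ] Y.Carrier := X.lattice.mapQ Y.lattice (mulVecInt N) h
  have hg : ∀ z, g (X.proj z) = Y.proj (N.mulVec z) := fun z => rfl
  refine ⟨g.toAddMonoidHom, ⟨?_, ?_, ?_⟩, hg⟩
  · exact isHolomorphic_of_affine (A := N) (b := 0) fun z => by rw [add_zero]; exact hg z
  · intro y
    obtain ⟨w, rfl⟩ := proj_surjective y
    obtain ⟨z, rfl⟩ := (mulVec_bijective hN).2 w
    exact ⟨X.proj z, hg z⟩
  · let e : (Fin 2 → ℂ) ≃ₗ[ℤ] (Fin 2 → ℂ) := LinearEquiv.ofBijective (mulVecInt N)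
      (mulVec_bijective hN)
    -- The kernel is the image of N⁻¹(Λ_Y), hence finitely generated. By `h'` it is torsion, so it
    -- is finite.
    have hker : LinearMap.ker g =
        (Y.lattice.map (e.symm : (Fin 2 → ℂ) →ₗ[ℤ] (Fin 2 → ℂ))).map X.lattice.mkQ := by
      ext x
      obtain ⟨z, rfl⟩ := proj_surjective x
      rw [LinearMap.mem_ker, hg, proj_eq_zero]
      constructor
      · intro hz
        exact ⟨z, ⟨_, hz, e.symm_apply_apply z⟩, rfl⟩
      · rintro ⟨_, ⟨l, hl, rfl⟩, hw⟩
        have h1 : e.symm l - z ∈ X.lattice := proj_eq_proj.mp hw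
        have h2 := h _ h1
        rw [Matrix.mulVec_sub] at h2
        have h3 : N.mulVec (e.symm l) = l := e.apply_symm_apply l
        rw [h3] at h2
        simpa using Y.lattice.sub_mem hl h2
    have hfg : (LinearMap.ker g).FG := by
      rw [hker]
      exact ((Module.Finite.iff_fg.mp inferInstance : Y.lattice.FG).map _).map _
    have : Module.Finite ℤ (LinearMap.ker g) := Module.Finite.iff_fg.mpr hfg
    refine Module.finite_of_fg_torsion (LinearMap.ker g) ?_
    rintro ⟨x, hx⟩
    obtain ⟨z, rfl⟩ := proj_surjective x
    rw [LinearMap.mem_ker, hg, proj_eq_zero] at hx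
    obtain ⟨n, hn, hz⟩ := exists_zsmul_mem_lattice (h' z hx)
    refine ⟨⟨n, mem_nonZeroDivisors_of_ne_zero hn⟩, ?_⟩
    ext
    exact (proj_eq_zero (X := X) (z := n • z)).mpr hz

/-- An isomorphism of rational spans induced by an invertible matrix has a multiple that induces an
isogeny. -/
theorem exists_isogeny_of_rationalSpan {M : Matrix (Fin 2) (Fin 2) ℂ} (hM : IsUnit M)
    (h : ∀ z, M.mulVec z ∈ Y.rationalSpan ↔ z ∈ X.rationalSpan) :
    ∃ (n : ℤ) (f : X.Carrier →+ Y.Carrier), n ≠ 0 ∧ IsIsogeny f ∧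
      ∀ z, f (X.proj z) = Y.proj (n • M.mulVec z) := by
  have h1 : ∀ i, ∃ n : ℤ, n ≠ 0 ∧ n • M.mulVec (X.realBasis i) ∈ Y.lattice := fun i =>
    exists_zsmul_mem_lattice ((h _).mpr
      (lattice_le_rationalSpan (by rw [realBasis_apply]; exact (X.latticeBasis i).2)))
  choose n hn hmem using h1
  -- The product clears the denominators of all four basis images at once.
  have hn0 : (∏ i, n i) ≠ 0 := Finset.prod_ne_zero_iff.mpr fun i _ => hn i
  have hN : IsUnit ((∏ i, n i) • M) := by
    rw [Matrix.isUnit_iff_isUnit_det] at hM ⊢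
    rw [← Int.cast_smul_eq_zsmul ℂ, Matrix.det_smul]
    exact ((IsUnit.mk0 _ (by exact_mod_cast hn0)).pow _).mul hM
  have h2 : ∀ z ∈ X.lattice, ((∏ i, n i) • M).mulVec z ∈ Y.lattice := by
    have : X.lattice ≤ Y.lattice.comap (mulVecInt ((∏ i, n i) • M)) := by
      rw [← span_realBasis, Submodule.span_le]
      rintro _ ⟨i, rfl⟩
      simp only [Submodule.comap_coe, Set.mem_preimage, mulVecInt_apply, SetLike.mem_coe,
        Matrix.smul_mulVec]
      rw [← Finset.mul_prod_erase _ _ (Finset.mem_univ i), mul_comm, mul_smul]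
      exact Y.lattice.smul_mem _ (hmem i)
    exact fun z hz => this hz
  have h3 : ∀ z, ((∏ i, n i) • M).mulVec z ∈ Y.lattice → z ∈ X.rationalSpan := by
    intro z hz
    rw [← h]
    rw [Matrix.smul_mulVec] at hz
    have := Y.rationalSpan.smul_mem ((∏ i, n i : ℤ) : ℚ)⁻¹ (lattice_le_rationalSpan hz)
    rwa [← Int.cast_smul_eq_zsmul ℚ, smul_smul, inv_mul_cancel₀ (by exact_mod_cast hn0),
      one_smul] at this
  obtain ⟨f, hf, hf'⟩ := exists_isIsogeny hN h2 h3
  exact ⟨∏ i, n i, f, hn0, hf, fun z => by rw [hf', Matrix.smul_mulVec]⟩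

theorem Isogenous.of_rationalSpan {M : Matrix (Fin 2) (Fin 2) ℂ} (hM : IsUnit M)
    (h : ∀ z, M.mulVec z ∈ Y.rationalSpan ↔ z ∈ X.rationalSpan) : Isogenous X Y := by
  obtain ⟨-, f, -, hf, -⟩ := exists_isogeny_of_rationalSpan hM h
  exact ⟨f, hf⟩

/-- The fibres of the first map are translates of its finite kernel, so the preimage of the second
finite kernel is finite. -/
theorem Isogenous.trans (h : Isogenous X Y) (h' : Isogenous Y Z) : Isogenous X Z := by
  obtain ⟨f, hf, hfs, hfk⟩ := h
  obtain ⟨g, hg, hgs, hgk⟩ := h'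
  refine ⟨g.comp f, ?_, hgs.comp hfs, ?_⟩
  · obtain ⟨A, b, hA⟩ := hf.exists_affine
    obtain ⟨B, c, hB⟩ := hg.exists_affine
    refine isHolomorphic_of_affine (A := B * A) (b := B.mulVec b + c) fun z => ?_
    rw [AddMonoidHom.coe_comp, Function.comp_apply, hA, hB, Matrix.mulVec_add,
      Matrix.mulVec_mulVec, add_assoc]
  · have h1 : ((g.comp f).ker : Set X.Carrier) = f ⁻¹' (g.ker : Set Y.Carrier) := by
      ext x; simp
    have h2 : ((g.comp f).ker : Set X.Carrier).Finite := by
      rw [h1]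
      refine Set.Finite.preimage' (Set.toFinite _) fun y _ => ?_
      obtain ⟨x, rfl⟩ := hfs y
      refine ((Set.toFinite (f.ker : Set X.Carrier)).image (x + ·)).subset fun x' hx' => ?_
      refine ⟨x' - x, ?_, by simp⟩
      have : f x' = f x := hx'
      simp [this]
    exact h2.to_subtype

theorem isogenyClass_eq (h : Isogenous X Y) (h' : Isogenous Y X) :
    isogenyClass X = isogenyClass Y :=
  Set.ext fun _ => ⟨fun hx => h'.trans hx, fun hy => h.trans hy⟩

/-- Equality of classes needs isogenies both ways; M⁻¹ supplies the one back. -/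
theorem isogenyClass_eq_of_rationalSpan {M : Matrix (Fin 2) (Fin 2) ℂ} (hM : IsUnit M)
    (h : ∀ z, M.mulVec z ∈ Y.rationalSpan ↔ z ∈ X.rationalSpan) :
    isogenyClass X = isogenyClass Y := by
  refine isogenyClass_eq (.of_rationalSpan hM h) (.of_rationalSpan (M := M⁻¹) ?_ fun z => ?_)
  · exact Matrix.isUnit_nonsing_inv_iff.mpr hM
  · rw [← h, Matrix.mulVec_mulVec, Matrix.mul_nonsing_inv _ ((Matrix.isUnit_iff_isUnit_det _).mp hM),
      Matrix.one_mulVec]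

theorem range_gaussianBasis (k : ℕ) : Set.range (gaussianBasis k) =
    ⋃ j : Fin 2, {Pi.single j 1, Pi.single j ((2 : ℂ) ^ k * Complex.I)} := by
  have h0 : ∀ j, gaussianBasis k ⟨j, 0⟩ = Pi.single j 1 := fun j => by
    simp [gaussianBasis, Module.Basis.isUnitSMul_apply]
  have h1 : ∀ j, gaussianBasis k ⟨j, 1⟩ = Pi.single j ((2 : ℂ) ^ k * Complex.I) := fun j => by
    simp [gaussianBasis, Module.Basis.isUnitSMul_apply]
  ext z
  simp only [Set.mem_range, Sigma.exists, Fin.exists_fin_two, Set.mem_iUnion, h0, h1,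
    Set.mem_insert_iff, Set.mem_singleton_iff, eq_comm (a := z)]

/-- The generators 2^k i and 2^l i are rational multiples of each other, so all these lattices have
the same rational span. -/
theorem rationalSpan_gaussianSquare_le (k l : ℕ) :
    (gaussianSquare k).rationalSpan ≤ (gaussianSquare l).rationalSpan := by
  have hl : ∀ x ∈ Set.range (gaussianBasis l), x ∈ (gaussianSquare l).rationalSpan := fun x hx =>
    lattice_le_rationalSpan (Submodule.subset_span hx)
  refine Submodule.span_le.mpr fun z hz => ?_
  have hz' : z ∈ Submodule.span ℤ (Set.range (gaussianBasis k)) := hz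
  suffices Submodule.span ℤ (Set.range (gaussianBasis k)) ≤
    (gaussianSquare l).rationalSpan.restrictScalars ℤ from this hz'
  rw [Submodule.span_le, range_gaussianBasis]
  intro x hx
  simp only [Set.mem_iUnion, Set.mem_insert_iff, Set.mem_singleton_iff] at hx
  obtain ⟨j, rfl | rfl⟩ := hx
  · exact hl _ (by rw [range_gaussianBasis]; exact Set.mem_iUnion.mpr ⟨j, by simp⟩)
  · have h1 : Pi.single j ((2 : ℂ) ^ l * Complex.I) ∈ (gaussianSquare l).rationalSpan :=
      hl _ (by rw [range_gaussianBasis]; exact Set.mem_iUnion.mpr ⟨j, by simp⟩)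
    have h2 := Submodule.smul_mem _ ((2 : ℚ) ^ k * (2 ^ l)⁻¹) h1
    rw [← Pi.single_smul', Rat.smul_def] at h2
    refine (congrArg (· ∈ (gaussianSquare l).rationalSpan) (congrArg _ ?_)).mp h2
    push_cast
    field_simp

theorem isogenous_gaussianSquare (k l : ℕ) :
    Isogenous (gaussianSquare k) (gaussianSquare l) := by
  refine .of_rationalSpan (M := 1) isUnit_one fun z => ?_
  rw [Matrix.one_mulVec]
  exact ⟨fun h => rationalSpan_gaussianSquare_le l k h,
    fun h => rationalSpan_gaussianSquare_le k l h⟩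

end ComplexTorus

/-! ### Upper and lower bounds for the entropy. -/

namespace ComplexTorus

open Dynamics UniformSpace ExpGrowth

variable {X : ComplexTorus} {f : X.Carrier → X.Carrier} {A : Matrix (Fin 2) (Fin 2) ℂ}
  {b : Fin 2 → ℂ}

/-- The translation b cancels in differences of orbits, so only the linear iterates A^k matter. -/
theorem iterate_add_proj (hf : ∀ z, f (X.proj z) = X.proj (A.mulVec z + b)) (k : ℕ)
    (x : X.Carrier) (v : Fin 2 → ℂ) :
    f^[k] (x + X.proj v) = f^[k] x + X.proj ((A ^ k).mulVec v) := by
  induction k generalizing x v with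
  | zero => simp
  | succ k ih =>
    obtain ⟨z, rfl⟩ := proj_surjective x
    have h1 : f (X.proj z + X.proj v) = f (X.proj z) + X.proj (A.mulVec v) := by
      rw [← proj_add, hf, hf, ← proj_add, Matrix.mulVec_add]
      congr 1; abel
    rw [Function.iterate_succ_apply, h1, ih, Function.iterate_succ_apply, Matrix.mulVec_mulVec,
      pow_succ]

theorem norm_proj_le (z : Fin 2 → ℂ) : ‖X.proj z‖ ≤ ‖z‖ := Submodule.Quotient.norm_mk_le _ _

theorem exists_rep_of_norm_lt {x : X.Carrier} {ε : ℝ} (h : ‖x‖ < ε) :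
    ∃ v, X.proj v = x ∧ ‖v‖ < ε := by
  obtain ⟨v, hv, hlt⟩ := Submodule.Quotient.norm_mk_lt x (sub_pos.mpr h)
  exact ⟨v, hv, by linarith⟩

/-- Small differences along an expanding eigenvector that stay small modulo the lattice for `n`
steps do so in the ambient space. -/
theorem norm_pow_mul_lt (hf : ∀ z, f (X.proj z) = X.proj (A.mulVec z + b)) {γ : ℂ}
    {e : Fin 2 → ℂ} (he : A.mulVec e = γ • e) (he1 : ‖e‖ = 1) {ε₀ ε : ℝ}
    (hε₀ : ∀ l ∈ X.lattice, ‖l‖ < ε₀ → l = 0) (hε : (‖γ‖ + 1) * ε ≤ ε₀) {s t : ℂ}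
    (hst : ‖t - s‖ < ε) {n : ℕ}
    (h : ∀ k < n, dist (f^[k] (X.proj (t • e))) (f^[k] (X.proj (s • e))) < ε) :
    ∀ k < n, ‖γ‖ ^ k * ‖t - s‖ < ε := by
  have hpow : ∀ k : ℕ, (A ^ k).mulVec e = γ ^ k • e := by
    intro k
    induction k with
    | zero => simp
    | succ k ih => rw [pow_succ', ← Matrix.mulVec_mulVec, ih, Matrix.mulVec_smul, he, smul_smul,
        pow_succ]
  intro k hk
  induction k with
  | zero => simpa using hst
  | succ k ih =>
    have h1 := ih (by omega)
    have h2 := h (k + 1) hk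
    have h3 : X.proj (t • e) = X.proj (s • e) + X.proj ((t - s) • e) := by
      rw [← proj_add, ← add_smul]; congr 2; ring
    rw [h3, iterate_add_proj hf, dist_eq_norm, add_sub_cancel_left, Matrix.mulVec_smul, hpow,
      smul_smul] at h2
    obtain ⟨v, hv, hlt⟩ := exists_rep_of_norm_lt h2
    rw [proj_eq_proj] at hv
    have hnorm : ‖((t - s) * γ ^ (k + 1)) • e‖ = ‖γ‖ * (‖γ‖ ^ k * ‖t - s‖) := by
      rw [norm_smul, he1, norm_mul, norm_pow]; ring
    -- One step stretches the difference to norm at most ‖γ‖ε, while its class has a representative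
    -- of norm below ε. The two differ by a lattice vector shorter than (‖γ‖ + 1)ε ≤ ε₀, hence by
    -- zero.
    have h4 : v - ((t - s) * γ ^ (k + 1)) • e = 0 := by
      refine hε₀ _ hv ((norm_sub_le _ _).trans_lt ?_)
      rw [hnorm]
      nlinarith [mul_le_mul_of_nonneg_left h1.le (norm_nonneg γ)]
    rw [sub_eq_zero] at h4
    rw [h4, hnorm] at hlt
    rw [pow_succ']; linarith

theorem norm_int_add_int_mul_I {a b : ℤ} (h : (a, b) ≠ 0) : 1 ≤ ‖(a + b * Complex.I : ℂ)‖ := by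
  have h1 : (1 : ℝ) ≤ (a : ℝ) ^ 2 + (b : ℝ) ^ 2 := by
    have : (1 : ℤ) ≤ a ^ 2 + b ^ 2 := by
      by_contra! hlt
      apply h
      have ha : a = 0 := by nlinarith [sq_nonneg a, sq_nonneg b]
      have hb : b = 0 := by nlinarith [sq_nonneg a, sq_nonneg b]
      simp [ha, hb]
    exact_mod_cast this
  have h2 := Complex.sq_norm (a + b * Complex.I : ℂ)
  rw [Complex.normSq_apply] at h2
  simp at h2
  nlinarith [norm_nonneg (a + b * Complex.I : ℂ)]

/-- An expanding eigenvector bounds the entropy from below. -/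
theorem le_coverEntropy (hf : ∀ z, f (X.proj z) = X.proj (A.mulVec z + b)) {γ : ℂ}
    (hγ : 1 < ‖γ‖) {e : Fin 2 → ℂ} (he0 : e ≠ 0) (he : A.mulVec e = γ • e) :
    ENNReal.log (ENNReal.ofReal (‖γ‖ ^ 2)) ≤ coverEntropy f Set.univ := by
  wlog he1 : ‖e‖ = 1 generalizing e
  · have hn : (‖e‖ : ℂ) ≠ 0 := by simpa using he0
    refine this (e := (‖e‖ : ℂ)⁻¹ • e) (smul_ne_zero (inv_ne_zero hn) he0) ?_ ?_
    · rw [Matrix.mulVec_smul, he, smul_comm]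
    · rw [norm_smul, norm_inv, Complex.norm_real, norm_norm, inv_mul_cancel₀ (by simpa using he0)]
  obtain ⟨ε₀, hε₀, hlat⟩ := X.exists_norm_lt_eq_zero
  obtain ⟨ε, hε, hεle⟩ : ∃ ε > 0, (‖γ‖ + 1) * ε ≤ ε₀ :=
    ⟨ε₀ / (‖γ‖ + 1), by positivity, by rw [mul_div_cancel₀]; positivity⟩
  -- With radius ε / 2, two dynamical balls that meet have centres within ε at each time, as
  -- `norm_pow_mul_lt` requires.
  have hU : {p : X.Carrier × X.Carrier | dist p.1 p.2 < ε / 2} ∈ uniformity X.Carrier :=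
    Metric.dist_mem_uniformity (half_pos hε)
  refine le_trans ?_ (netEntropyEntourage_le_coverEntropy (T := f) Set.univ hU)
  rw [netEntropyEntourage, ← expGrowthSup_pow]
  have hγ0 : 0 < ‖γ‖ := by linarith
  -- The net below has N² ≥ (‖γ‖^m / 2)² points for n = m + 1; this shift and the halving account
  -- for 1 / (4‖γ‖²).
  refine expGrowthSup_of_eventually_ge (b := ENNReal.ofReal (1 / (4 * ‖γ‖ ^ 2))) (by positivity) ?_
  filter_upwards [Filter.eventually_ge_atTop 1] with n hn
  obtain ⟨m, rfl⟩ : ∃ m, n = m + 1 := ⟨n - 1, by omega⟩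
  -- Index differences are at most N − 1 < ‖γ‖^m / 2. With spacing σ = ε / ‖γ‖^m all grid points
  -- then start within ε of each other, while the spacing itself grows to ε at time m.
  set N := ⌈‖γ‖ ^ m / 2⌉₊ with hN
  have hNpos : 0 < N := Nat.ceil_pos.mpr (by positivity)
  have hN1 : ‖γ‖ ^ m / 2 ≤ N := Nat.le_ceil _
  have hN2 : (N : ℝ) < ‖γ‖ ^ m / 2 + 1 := Nat.ceil_lt_add_one (by positivity)
  set σ := ε / ‖γ‖ ^ m with hσ
  have hσpos : 0 < σ := by positivity
  let τ : ℕ × ℕ → ℂ := fun p => (σ : ℂ) * (p.1 + p.2 * Complex.I)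
  let g : ℕ × ℕ → X.Carrier := fun p => X.proj (τ p • e)
  let I := Finset.range N ×ˢ Finset.range N
  have key : ∀ p ∈ I, ∀ q ∈ I, p ≠ q → Disjoint
      (ball (g p) (dynEntourage f {p : X.Carrier × X.Carrier | dist p.1 p.2 < ε / 2} (m + 1)))
      (ball (g q) (dynEntourage f {p : X.Carrier × X.Carrier | dist p.1 p.2 < ε / 2} (m + 1))) := by
    intro p hp q hq hpq
    rw [Set.disjoint_left]
    intro y hy hy'
    rw [mem_ball_dynEntourage] at hy hy'
    have hdiff : τ p - τ q = (σ : ℂ) * (((p.1 - q.1 : ℤ) : ℂ) + ((p.2 - q.2 : ℤ) : ℂ) * Complex.I) := by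
      simp only [τ]; push_cast; ring
    have hge : σ ≤ ‖τ p - τ q‖ := by
      rw [hdiff, norm_mul, Complex.norm_real, Real.norm_of_nonneg hσpos.le]
      refine le_mul_of_one_le_right hσpos.le (norm_int_add_int_mul_I fun h => hpq ?_)
      simp only [Prod.mk_eq_zero] at h
      ext <;> omega
    have hlt : ‖τ p - τ q‖ < ε := by
      rw [hdiff, norm_mul, Complex.norm_real, Real.norm_of_nonneg hσpos.le]
      simp only [I, Finset.mem_product, Finset.mem_range] at hp hq
      have ha : |((p.1 - q.1 : ℤ) : ℝ)| ≤ N - 1 := by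
        have : |(p.1 - q.1 : ℤ)| ≤ N - 1 := by rw [abs_le]; omega
        exact_mod_cast this
      have hb : |((p.2 - q.2 : ℤ) : ℝ)| ≤ N - 1 := by
        have : |(p.2 - q.2 : ℤ)| ≤ N - 1 := by rw [abs_le]; omega
        exact_mod_cast this
      have h1 : ‖(((p.1 - q.1 : ℤ) : ℂ) + ((p.2 - q.2 : ℤ) : ℂ) * Complex.I)‖ < ‖γ‖ ^ m := by
        refine (norm_add_le _ _).trans_lt ?_
        rw [norm_mul, Complex.norm_I, mul_one, Complex.norm_intCast, Complex.norm_intCast]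
        linarith
      calc _ < σ * ‖γ‖ ^ m := by gcongr
        _ = ε := by rw [hσ]; field_simp
    have h2 := norm_pow_mul_lt hf he he1 hlat hεle hlt (n := m + 1) (fun k hk => by
      have h3 : dist (f^[k] (g p)) (f^[k] y) < ε / 2 := hy k hk
      have h4 : dist (f^[k] (g q)) (f^[k] y) < ε / 2 := hy' k hk
      have := dist_triangle_right (f^[k] (g p)) (f^[k] (g q)) (f^[k] y)
      simp only [g] at this h3 h4
      linarith) m (by omega)
    have h5 : ε = ‖γ‖ ^ m * σ := by rw [hσ]; field_simp
    have h6 : ‖γ‖ ^ m * σ ≤ ‖γ‖ ^ m * ‖τ p - τ q‖ := by gcongr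
    linarith
  have hself : ∀ x : X.Carrier, x ∈ ball x (dynEntourage f
      {p : X.Carrier × X.Carrier | dist p.1 p.2 < ε / 2} (m + 1)) := fun x => by
    rw [mem_ball_dynEntourage]
    intro k _
    show dist _ _ < ε / 2
    rw [dist_self]; positivity
  have hinj : Set.InjOn g I := fun p hp q hq h => by
    by_contra hne
    exact Set.disjoint_left.mp (key p hp q hq hne) (hself _) (h ▸ hself _)
  classical
  have hnet : IsDynNetIn f Set.univ {p : X.Carrier × X.Carrier | dist p.1 p.2 < ε / 2} (m + 1)
      (I.image g : Finset X.Carrier) := by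
    refine ⟨Set.subset_univ _, ?_⟩
    rintro _ hx _ hy hxy
    simp only [Finset.coe_image, Set.mem_image, Finset.mem_coe] at hx hy
    obtain ⟨p, hp, rfl⟩ := hx
    obtain ⟨q, hq, rfl⟩ := hy
    exact key p hp q hq fun h => hxy (h ▸ rfl)
  have hcard := hnet.card_le_netMaxcard
  rw [Finset.card_image_of_injOn hinj, Finset.card_product, Finset.card_range] at hcard
  have hcard' : ((N * N : ℕ) : ENNReal) ≤ (netMaxcard f Set.univ
      {p : X.Carrier × X.Carrier | dist p.1 p.2 < ε / 2} (m + 1) : ENNReal) := by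
    exact_mod_cast (ENat.toENNReal_le.mpr hcard)
  refine le_trans ?_ hcard'
  rw [← ENNReal.ofReal_pow (by positivity), ← ENNReal.ofReal_mul (by positivity),
    ← ENNReal.ofReal_natCast]
  refine ENNReal.ofReal_le_ofReal ?_
  have h7 : 1 / (4 * ‖γ‖ ^ 2) * (‖γ‖ ^ 2) ^ (m + 1) = (‖γ‖ ^ m / 2) * (‖γ‖ ^ m / 2) := by
    field_simp; ring
  rw [h7]; push_cast
  gcongr

/-- A finite grid in a disc. -/
theorem exists_grid (R : ℝ) {δ : ℝ} (hδ : 0 < δ) (hR : 0 ≤ R) :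
    ∃ G : Finset ℂ, (G.card : ℝ) ≤ (2 * R / δ + 5) ^ 2 ∧
      ∀ w : ℂ, ‖w‖ ≤ R → ∃ g ∈ G, ‖w - g‖ ≤ δ := by
  classical
  -- The extra 1 absorbs the rounding error, which is at most 1 / 2.
  set N : ℕ := ⌈R / δ⌉₊ + 1 with hN
  let J := Finset.Icc (-(N : ℤ)) N
  have hJ : J.card = 2 * N + 1 := by simp [J]; omega
  have hround : ∀ x : ℝ, |x| ≤ R → round (x / δ) ∈ J := by
    intro x hx
    have h1 := abs_sub_round (x / δ)
    have h2 : |x / δ| ≤ R / δ := by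
      rw [abs_div, abs_of_pos hδ]; gcongr
    have h3 := Nat.le_ceil (R / δ)
    have h4 : |((round (x / δ) : ℤ) : ℝ)| ≤ N := by
      rw [hN]; push_cast
      have := abs_sub_abs_le_abs_sub ((round (x / δ) : ℤ) : ℝ) (x / δ)
      rw [abs_sub_comm] at this
      linarith
    have h5 : |round (x / δ)| ≤ (N : ℤ) := by exact_mod_cast h4
    simpa [J, abs_le] using h5
  refine ⟨(J ×ˢ J).image fun p => (δ : ℂ) * (p.1 + p.2 * Complex.I), ?_, fun w hw => ?_⟩
  · have h1 : ((((J ×ˢ J).image fun p => (δ : ℂ) * (p.1 + p.2 * Complex.I)).card : ℕ) : ℝ) ≤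
        ((2 * N + 1 : ℕ) : ℝ) ^ 2 := by
      have := Finset.card_image_le (s := J ×ˢ J)
        (f := fun p : ℤ × ℤ => (δ : ℂ) * (p.1 + p.2 * Complex.I))
      rw [Finset.card_product, hJ, ← sq] at this
      exact_mod_cast this
    refine h1.trans ?_
    have h2 : (N : ℝ) ≤ R / δ + 2 := by
      have := (Nat.ceil_lt_add_one (div_nonneg hR hδ.le)).le
      rw [hN]; push_cast; linarith
    gcongr
    push_cast
    rw [mul_div_assoc]; linarith
  · refine ⟨_, Finset.mem_image_of_mem _ (Finset.mem_product (p := (round (w.re / δ),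
      round (w.im / δ))) |>.mpr
      ⟨hround w.re ((Complex.abs_re_le_norm w).trans hw),
        hround w.im ((Complex.abs_im_le_norm w).trans hw)⟩), ?_⟩
    have hr : ∀ x : ℝ, |x - δ * round (x / δ)| ≤ δ / 2 := by
      intro x
      have h1 := abs_sub_round (x / δ)
      have h2 : x - δ * round (x / δ) = δ * (x / δ - round (x / δ)) := by field_simp
      rw [h2, abs_mul, abs_of_pos hδ]
      nlinarith
    refine (Complex.norm_le_abs_re_add_abs_im _).trans ?_
    have h1 := hr w.re
    have h2 := hr w.im
    simp only [Complex.sub_re, Complex.sub_im, Complex.mul_re, Complex.mul_im, Complex.ofReal_re,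
      Complex.ofReal_im, Complex.add_re, Complex.add_im, Complex.intCast_re, Complex.intCast_im,
      Complex.I_re, Complex.I_im]
    ring_nf at h1 h2 ⊢
    linarith

/-- Coordinates in which the growth of the iterates is controlled bound the entropy from above. -/
theorem coverEntropy_le (hf : ∀ z, f (X.proj z) = X.proj (A.mulVec z + b))
    {S : Matrix (Fin 2) (Fin 2) ℂ} (hS : IsUnit S) {C ρ₀ ρ₁ : ℝ} (hC : 0 < C) (h0 : 1 ≤ ρ₀)
    (h1 : 1 ≤ ρ₁)
    (h : ∀ (k : ℕ) w, ‖(A ^ k).mulVec (S.mulVec w)‖ ≤ C * (ρ₀ ^ k * ‖w 0‖ + ρ₁ ^ k * ‖w 1‖)) :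
    coverEntropy f Set.univ ≤ ENNReal.log (ENNReal.ofReal ((ρ₀ * ρ₁) ^ 2)) := by
  classical
  obtain ⟨R, hR, hrep⟩ := X.exists_bound_rep
  obtain ⟨R', hR', hrep'⟩ : ∃ R' > 0, ∀ z : Fin 2 → ℂ, ∃ w, (∀ i, ‖w i‖ ≤ R') ∧
      X.proj z = X.proj (S.mulVec w) := by
    let L := S⁻¹.mulVecLin.toContinuousLinearMap
    refine ⟨‖L‖ * R + 1, by positivity, fun z => ?_⟩
    obtain ⟨y, hy, hl⟩ := hrep z
    refine ⟨L y, fun i => ?_, ?_⟩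
    · have h1 := norm_le_pi_norm (L y) i
      have h2 := L.le_opNorm y
      have h3 : ‖L‖ * ‖y‖ ≤ ‖L‖ * R := by gcongr
      linarith
    · have : S.mulVec (L y) = y := by
        show S.mulVec (S⁻¹.mulVec y) = y
        rw [Matrix.mulVec_mulVec, Matrix.mul_nonsing_inv _ ((Matrix.isUnit_iff_isUnit_det _).mp hS),
          Matrix.one_mulVec]
      rwa [this, proj_eq_proj]
  refine iSup₂_le fun U hU => ?_
  obtain ⟨ε, hε, hεU⟩ := Metric.mem_uniformity_dist.mp hU
  -- Each coordinate contributes at most r along the orbit, so distances stay below 2Cr = ε / 2.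
  set r := ε / (4 * C) with hr
  have hrpos : 0 < r := by positivity
  set K := 2 * R' / r + 5 with hK
  have hKpos : 0 < K := by positivity
  rw [coverEntropyEntourage, ← expGrowthSup_pow]
  refine expGrowthSup_le_of_eventually_le (b := ENNReal.ofReal (K ^ 4)) ENNReal.ofReal_ne_top ?_
  refine Filter.Eventually.of_forall fun n => ?_
  have hρ₀ : 0 < ρ₀ := by linarith
  have hρ₁ : 0 < ρ₁ := by linarith
  -- Each coordinate gets a mesh refined by its own growth factor, so the product grid has at most
  -- K⁴(ρ₀ρ₁)^(2n) points.
  obtain ⟨G₀, hG₀, hG₀'⟩ := exists_grid R' (δ := r / ρ₀ ^ n) (by positivity) hR'.le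
  obtain ⟨G₁, hG₁, hG₁'⟩ := exists_grid R' (δ := r / ρ₁ ^ n) (by positivity) hR'.le
  have hbound : ∀ ρ : ℝ, 1 ≤ ρ → 2 * R' / (r / ρ ^ n) + 5 ≤ K * ρ ^ n := by
    intro ρ hρ
    have : 1 ≤ ρ ^ n := one_le_pow₀ hρ
    have h2 : 2 * R' / (r / ρ ^ n) = 2 * R' / r * ρ ^ n := by field_simp
    rw [h2, hK, add_mul]; linarith
  let s : Finset X.Carrier := (G₀ ×ˢ G₁).image fun p => X.proj (S.mulVec ![p.1, p.2])
  have hs : IsDynCoverOf f Set.univ U n s := by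
    intro x _
    obtain ⟨z, rfl⟩ := proj_surjective x
    obtain ⟨w, hw, hz⟩ := hrep' z
    obtain ⟨g₀, hg₀, hd₀⟩ := hG₀' (w 0) (hw 0)
    obtain ⟨g₁, hg₁, hd₁⟩ := hG₁' (w 1) (hw 1)
    refine ⟨X.proj (S.mulVec ![g₀, g₁]), ?_, ?_⟩
    · simp only [s, Finset.coe_image, Set.mem_image, Finset.mem_coe]
      exact ⟨(g₀, g₁), Finset.mem_product.mpr ⟨hg₀, hg₁⟩, rfl⟩
    · show (X.proj z, X.proj (S.mulVec ![g₀, g₁])) ∈ dynEntourage f U n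
      rw [mem_dynEntourage]
      intro k hk
      apply hεU
      have h3 : X.proj z = X.proj (S.mulVec ![g₀, g₁]) +
          X.proj (S.mulVec (w - ![g₀, g₁])) := by
        rw [hz, ← proj_add, ← Matrix.mulVec_add]; congr 2; abel
      rw [h3, iterate_add_proj hf, dist_eq_norm, add_sub_cancel_left]
      refine (norm_proj_le _).trans_lt ((h k _).trans_lt ?_)
      have h4 : ∀ ρ : ℝ, 1 ≤ ρ → ∀ x : ℝ, x ≤ r / ρ ^ n → ρ ^ k * x ≤ r := by
        intro ρ hρ x hx
        have hρ' : 0 < ρ := by linarith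
        have : ρ ^ k ≤ ρ ^ n := pow_le_pow_right₀ hρ hk.le
        calc ρ ^ k * x ≤ ρ ^ k * (r / ρ ^ n) := by gcongr
          _ ≤ ρ ^ n * (r / ρ ^ n) := by gcongr
          _ = r := by field_simp
      have h5 := h4 ρ₀ h0 _ hd₀
      have h6 := h4 ρ₁ h1 _ hd₁
      simp only [Pi.sub_apply, Matrix.cons_val_zero, Matrix.cons_val_one]
      calc _ ≤ C * (r + r) := by gcongr
        _ = ε / 2 := by rw [hr]; field_simp; ring
        _ < ε := by linarith
  have h7 := hs.coverMincard_le_card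
  have h8 : (coverMincard f Set.univ U n : ENNReal) ≤ ((s.card : ℕ) : ENNReal) := by
    exact_mod_cast (ENat.toENNReal_le.mpr h7)
  refine h8.trans ?_
  rw [← ENNReal.ofReal_pow (by positivity), ← ENNReal.ofReal_mul (by positivity),
    ← ENNReal.ofReal_natCast]
  refine ENNReal.ofReal_le_ofReal ?_
  have h9 : (s.card : ℝ) ≤ G₀.card * G₁.card := by
    have := Finset.card_image_le (s := G₀ ×ˢ G₁)
      (f := fun p : ℂ × ℂ => X.proj (S.mulVec ![p.1, p.2]))
    rw [Finset.card_product] at this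
    exact_mod_cast this
  have h10 : (2 * R' / (r / ρ₀ ^ n) + 5) ^ 2 ≤ (K * ρ₀ ^ n) ^ 2 := by
    gcongr; exact hbound _ h0
  have h11 : (2 * R' / (r / ρ₁ ^ n) + 5) ^ 2 ≤ (K * ρ₁ ^ n) ^ 2 := by
    gcongr; exact hbound _ h1
  calc (s.card : ℝ) ≤ G₀.card * G₁.card := h9
    _ ≤ (K * ρ₀ ^ n) ^ 2 * (K * ρ₁ ^ n) ^ 2 := by
      gcongr
      · exact hG₀.trans h10
      · exact hG₁.trans h11
    _ = K ^ 4 * ((ρ₀ * ρ₁) ^ 2) ^ n := by rw [mul_pow, mul_pow, mul_pow]; ring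

end ComplexTorus

/-! ### Eigenvalues and growth of 2 × 2 complex matrices. -/

theorem Matrix.exists_eigenvector_fin_two {A : Matrix (Fin 2) (Fin 2) ℂ} {γ₁ γ₂ : ℂ}
    (htr : A.trace = γ₁ + γ₂) (hdet : A.det = γ₁ * γ₂) :
    ∃ e : Fin 2 → ℂ, e ≠ 0 ∧ A.mulVec e = γ₁ • e := by
  have h : (A - γ₁ • (1 : Matrix (Fin 2) (Fin 2) ℂ)).det = 0 := by
    rw [Matrix.trace_fin_two] at htr
    rw [Matrix.det_fin_two] at hdet ⊢
    simp
    linear_combination hdet - γ₁ * htr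
  obtain ⟨e, he, h⟩ := Matrix.exists_mulVec_eq_zero_iff.mpr h
  refine ⟨e, he, ?_⟩
  rwa [Matrix.sub_mulVec, Matrix.smul_mulVec, Matrix.one_mulVec, sub_eq_zero] at h

/-- A two by two complex matrix with distinct eigenvalues is diagonalizable. -/
theorem Matrix.exists_diagonalization_fin_two {A : Matrix (Fin 2) (Fin 2) ℂ} {γ₁ γ₂ : ℂ}
    (htr : A.trace = γ₁ + γ₂) (hdet : A.det = γ₁ * γ₂) (hne : γ₁ ≠ γ₂) :
    ∃ S : Matrix (Fin 2) (Fin 2) ℂ, IsUnit S ∧ A * S = S * Matrix.diagonal ![γ₁, γ₂] := by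
  obtain ⟨e₁, h₁, he₁⟩ := Matrix.exists_eigenvector_fin_two htr hdet
  obtain ⟨e₂, h₂, he₂⟩ := Matrix.exists_eigenvector_fin_two (γ₁ := γ₂) (γ₂ := γ₁)
    (by rw [htr, add_comm]) (by rw [hdet, mul_comm])
  have hS : ∀ w : Fin 2 → ℂ, (Matrix.of ![e₁, e₂]).transpose.mulVec w = w 0 • e₁ + w 1 • e₂ := by
    intro w
    ext i
    simp [Matrix.mulVec, dotProduct, Fin.sum_univ_two, mul_comm]
  refine ⟨(Matrix.of ![e₁, e₂]).transpose, ?_, ?_⟩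
  · rw [Matrix.isUnit_iff_isUnit_det, isUnit_iff_ne_zero]
    intro h0
    obtain ⟨w, hw, h⟩ := Matrix.exists_mulVec_eq_zero_iff.mpr h0
    rw [hS] at h
    have h3 := congrArg A.mulVec h
    rw [Matrix.mulVec_add, Matrix.mulVec_smul, Matrix.mulVec_smul, he₁, he₂,
      Matrix.mulVec_zero] at h3
    have h4 : (w 0 * (γ₁ - γ₂)) • e₁ = 0 := by
      have : (w 0 * (γ₁ - γ₂)) • e₁ = (w 0 • γ₁ • e₁ + w 1 • γ₂ • e₂) -
          γ₂ • (w 0 • e₁ + w 1 • e₂) := by module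
      rw [this, h3, h, smul_zero, sub_zero]
    have hw0 : w 0 = 0 := by simpa [h₁, sub_ne_zero.mpr hne] using h4
    rw [hw0, zero_smul, zero_add] at h
    have hw1 : w 1 = 0 := by simpa [h₂] using h
    exact hw (by ext i; fin_cases i <;> simp [hw0, hw1])
  · apply Matrix.ext_of_mulVec_single
    intro i
    rw [← Matrix.mulVec_mulVec, ← Matrix.mulVec_mulVec, hS, hS, Matrix.mulVec_add,
      Matrix.mulVec_smul, Matrix.mulVec_smul, he₁, he₂, Matrix.mulVec_diagonal,
      Matrix.mulVec_diagonal, smul_smul, smul_smul]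
    simp [mul_comm]

/-- The iterates of a matrix whose eigenvalues lie on the unit circle grow subexponentially. -/
theorem Matrix.norm_pow_mulVec_le_of_norm_eq_one {A : Matrix (Fin 2) (Fin 2) ℂ} {γ₁ γ₂ : ℂ}
    (htr : A.trace = γ₁ + γ₂) (hdet : A.det = γ₁ * γ₂) (h₁ : ‖γ₁‖ = 1) (h₂ : ‖γ₂‖ = 1)
    {η : ℝ} (hη : 0 < η) :
    ∃ C > 0, ∀ (k : ℕ) w, ‖(A ^ k).mulVec w‖ ≤ C * ((1 + η) ^ k * ‖w‖) := by
  let B := A - γ₁ • (1 : Matrix (Fin 2) (Fin 2) ℂ)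
  have hB : ∀ w, A.mulVec w = γ₁ • w + B.mulVec w := fun w => by
    simp only [B, Matrix.sub_mulVec, Matrix.smul_mulVec, Matrix.one_mulVec]; abel
  -- Cayley–Hamilton: (A − γ₁)(A − γ₂) = 0.
  have hBA : B * A = γ₂ • B := by
    rw [Matrix.trace_fin_two] at htr
    rw [Matrix.det_fin_two] at hdet
    ext i j
    fin_cases i <;> fin_cases j <;> simp [B, Matrix.mul_apply, Fin.sum_univ_two]
    · linear_combination A 0 0 * htr - hdet
    · linear_combination A 0 1 * htr
    · linear_combination A 1 0 * htr
    · linear_combination A 1 1 * htr - hdet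
  let L := B.mulVecLin.toContinuousLinearMap
  have hL : ∀ w, ‖B.mulVec w‖ ≤ ‖L‖ * ‖w‖ := fun w => L.le_opNorm w
  -- Since |γ₂| = 1, A preserves ‖Bw‖. So the adapted norm η‖w‖ + ‖Bw‖ grows by at most 1 + η per
  -- step, even for a nontrivial Jordan block.
  have hstep : ∀ w, η * ‖A.mulVec w‖ + ‖B.mulVec (A.mulVec w)‖ ≤
      (1 + η) * (η * ‖w‖ + ‖B.mulVec w‖) := by
    intro w
    have e1 : ‖B.mulVec (A.mulVec w)‖ = ‖B.mulVec w‖ := by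
      rw [Matrix.mulVec_mulVec, hBA, Matrix.smul_mulVec, norm_smul, h₂, one_mul]
    have e2 : ‖A.mulVec w‖ ≤ ‖w‖ + ‖B.mulVec w‖ := by
      rw [hB]; refine (norm_add_le _ _).trans ?_
      rw [norm_smul, h₁, one_mul]
    rw [e1]
    nlinarith [norm_nonneg w, norm_nonneg (B.mulVec w), mul_le_mul_of_nonneg_left e2 hη.le,
      mul_nonneg (sq_nonneg η) (norm_nonneg w)]
  have hiter : ∀ (k : ℕ) w, η * ‖(A ^ k).mulVec w‖ + ‖B.mulVec ((A ^ k).mulVec w)‖ ≤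
      (1 + η) ^ k * (η * ‖w‖ + ‖B.mulVec w‖) := by
    intro k w
    induction k with
    | zero => simp
    | succ k ih =>
      rw [pow_succ', ← Matrix.mulVec_mulVec]
      refine (hstep _).trans ?_
      rw [pow_succ', mul_assoc]
      gcongr
  refine ⟨(η + ‖L‖) / η, by positivity, fun k w => ?_⟩
  rw [div_mul_eq_mul_div, le_div_iff₀ hη]
  have h3 := hiter k w
  have h4 : (1 + η) ^ k * (η * ‖w‖ + ‖B.mulVec w‖) ≤ (1 + η) ^ k * (η * ‖w‖ + ‖L‖ * ‖w‖) := by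
    gcongr; exact hL w
  have := norm_nonneg (B.mulVec ((A ^ k).mulVec w))
  linarith

/-! ### The entropy formula. -/

namespace ComplexTorus

open Dynamics

variable {X : ComplexTorus} {f : X.Carrier → X.Carrier} {A : Matrix (Fin 2) (Fin 2) ℂ}
  {b : Fin 2 → ℂ}

/-- The entropy of an automorphism of a complex torus in terms of its eigenvalues. -/
theorem coverEntropy_eq (hf : ∀ z, f (X.proj z) = X.proj (A.mulVec z + b)) {γ₁ γ₂ : ℂ}
    (htr : A.trace = γ₁ + γ₂) (hdet : A.det = γ₁ * γ₂) (hle : ‖γ₂‖ ≤ ‖γ₁‖)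
    (hone : ‖γ₁ * γ₂‖ = 1) :
    coverEntropy f Set.univ = (Real.log (‖γ₁‖ ^ 2) : EReal) := by
  rw [norm_mul] at hone
  have h1 : 1 ≤ ‖γ₁‖ := by nlinarith [norm_nonneg γ₁, norm_nonneg γ₂]
  rw [← ENNReal.log_ofReal_of_pos (by positivity)]
  rcases h1.lt_or_eq with h1 | h1
  · have h2 : ‖γ₂‖ < 1 := by nlinarith [norm_nonneg γ₂]
    refine le_antisymm ?_ ?_
    · obtain ⟨S, hS, hAS⟩ := Matrix.exists_diagonalization_fin_two htr hdet
        (fun h => by rw [h] at h1; linarith)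
      let L := S.mulVecLin.toContinuousLinearMap
      have hpow : ∀ k : ℕ, A ^ k * S = S * Matrix.diagonal ![γ₁, γ₂] ^ k := by
        intro k
        induction k with
        | zero => simp
        | succ k ih => rw [pow_succ', mul_assoc, ih, ← mul_assoc, hAS, mul_assoc, ← pow_succ']
      -- The contracting direction is given rate 1, which adds nothing to the product of the rates.
      have := coverEntropy_le hf hS (C := ‖L‖ + 1) (ρ₀ := ‖γ₁‖) (ρ₁ := 1) (by positivity) h1.le
        le_rfl fun k w => ?_
      · simpa using this
      rw [Matrix.mulVec_mulVec, hpow, ← Matrix.mulVec_mulVec]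
      refine (L.le_opNorm _).trans ?_
      have h3 : ‖(Matrix.diagonal ![γ₁, γ₂] ^ k).mulVec w‖ ≤ ‖γ₁‖ ^ k * ‖w 0‖ + 1 ^ k * ‖w 1‖ := by
        rw [pi_norm_le_iff_of_nonneg (by positivity)]
        intro i
        rw [Matrix.diagonal_pow, Matrix.mulVec_diagonal]
        fin_cases i
        · simp
        · have : ‖γ₂‖ ^ k ≤ 1 := pow_le_one₀ (norm_nonneg _) h2.le
          simp
          have h4 : ‖γ₂‖ ^ k * ‖w 1‖ ≤ 1 * ‖w 1‖ := by gcongr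
          have : 0 ≤ ‖γ₁‖ ^ k * ‖w 0‖ := by positivity
          linarith
      gcongr
      linarith
    · obtain ⟨e, he, hAe⟩ := Matrix.exists_eigenvector_fin_two htr hdet
      exact le_coverEntropy hf h1 he hAe
  · have h2 : ‖γ₂‖ = 1 := by rw [← h1, one_mul] at hone; exact hone
    refine le_antisymm ?_ ?_
    · rw [← h1]
      -- A possible Jordan block allows only the rate 1 + η; let η tend to 0.
      refine ge_of_tendsto (f := fun η : ℝ => ENNReal.log (ENNReal.ofReal (((1 + η) * (1 + η)) ^ 2)))
        (x := nhdsWithin 0 (Set.Ioi 0)) ?_ ?_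
      · have hc : Continuous fun η : ℝ =>
            ENNReal.log (ENNReal.ofReal (((1 + η) * (1 + η)) ^ 2)) :=
          ENNReal.continuous_log.comp (ENNReal.continuous_ofReal.comp (by fun_prop))
        have := hc.tendsto 0
        simp only [add_zero, mul_one, one_pow] at this ⊢
        exact this.mono_left nhdsWithin_le_nhds
      · filter_upwards [self_mem_nhdsWithin] with η hη
        have hη : 0 < η := hη
        obtain ⟨C, hC, h⟩ :=
          Matrix.norm_pow_mulVec_le_of_norm_eq_one htr hdet h1.symm h2 hη
        refine coverEntropy_le hf isUnit_one hC (by linarith) (by linarith) fun k w => ?_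
        rw [Matrix.one_mulVec]
        refine (h k w).trans ?_
        rw [← mul_add]
        gcongr
        rw [pi_norm_le_iff_of_nonneg (by positivity)]
        intro i
        fin_cases i <;> simp
    · rw [← h1]
      simpa using coverEntropy_nonneg f (Set.univ_nonempty)

end ComplexTorus

/-! ### The characteristic polynomial on the lattice. -/

namespace ComplexTorus

variable {X Y : ComplexTorus}

/-- The endomorphism of the lattice induced by a matrix that preserves it. -/
noncomputable def latticeMap (A : Matrix (Fin 2) (Fin 2) ℂ)
    (hA : ∀ z ∈ X.lattice, A.mulVec z ∈ X.lattice) : X.lattice →ₗ[ℤ] X.lattice :=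
  (mulVecInt A).restrict hA

/-- A basis of Λ is a real basis of ℂ², so this is the determinant of A as a real-linear map, which
is the norm from ℂ to ℝ of its complex determinant. -/
theorem det_latticeMap {A : Matrix (Fin 2) (Fin 2) ℂ}
    (hA : ∀ z ∈ X.lattice, A.mulVec z ∈ X.lattice) :
    ((LinearMap.det (latticeMap A hA) : ℤ) : ℝ) = ‖A.det‖ ^ 2 := by
  have h1 : LinearMap.toMatrix X.realBasis X.realBasis (A.mulVecLin.restrictScalars ℝ) =
      (LinearMap.toMatrix X.latticeBasis X.latticeBasis (latticeMap A hA)).map (Int.cast) := by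
    ext i j
    rw [LinearMap.toMatrix_apply, Matrix.map_apply, LinearMap.toMatrix_apply, realBasis_apply]
    exact X.latticeBasis.ofZLatticeBasis_repr_apply ℝ X.lattice
      (latticeMap A hA (X.latticeBasis j)) i
  have h2 : (LinearMap.det (A.mulVecLin.restrictScalars ℝ) : ℝ) = ‖A.det‖ ^ 2 := by
    rw [LinearMap.det_restrictScalars, Algebra.norm_complex_apply, ← Complex.sq_norm]
    congr 2
    exact LinearMap.det_toLin' A
  rw [← LinearMap.det_toMatrix X.latticeBasis, ← h2, ← LinearMap.det_toMatrix X.realBasis, h1,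
    Int.cast_det]

/-- The integral determinant is a unit of ℤ, and it is nonnegative because it equals |det A|². -/
theorem norm_det_eq_one {A : Matrix (Fin 2) (Fin 2) ℂ} (hA : IsUnit A)
    (h : ∀ z, A.mulVec z ∈ X.lattice ↔ z ∈ X.lattice) : ‖A.det‖ = 1 := by
  have hdet := det_latticeMap (A := A) (X := X) fun z hz => (h z).mpr hz
  have hbij : Function.Bijective (latticeMap A fun z hz => (h z).mpr hz) := by
    constructor
    · rintro ⟨z, hz⟩ ⟨w, hw⟩ hzw
      exact Subtype.ext ((mulVec_bijective hA).1 (congrArg Subtype.val hzw))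
    · rintro ⟨w, hw⟩
      obtain ⟨z, rfl⟩ := (mulVec_bijective hA).2 w
      exact ⟨⟨z, (h z).mp hw⟩, rfl⟩
  have hu : IsUnit (LinearMap.det (latticeMap (X := X) A fun z hz => (h z).mpr hz)) :=
    LinearEquiv.isUnit_det' (LinearEquiv.ofBijective _ hbij)
  have h0 : (0 : ℝ) ≤ ((LinearMap.det (latticeMap (X := X) A fun z hz => (h z).mpr hz) : ℤ) : ℝ) := by
    rw [hdet]; positivity
  rcases Int.isUnit_iff.mp hu with h1 | h1
  · rw [h1] at hdet
    have : ‖A.det‖ ^ 2 = 1 := by rw [← hdet]; simp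
    exact (pow_eq_one_iff_of_nonneg (norm_nonneg _) two_ne_zero).mp this
  · rw [h1] at h0; norm_num at h0

/-- The characteristic polynomial of the action on the lattice has roots `γ₁, γ̄₁, γ₂, γ̄₂`. -/
theorem exists_charpoly {A : Matrix (Fin 2) (Fin 2) ℂ} (hA : IsUnit A)
    (h : ∀ z, A.mulVec z ∈ X.lattice ↔ z ∈ X.lattice) {γ₁ γ₂ : ℂ}
    (htr : A.trace = γ₁ + γ₂) (hdet : A.det = γ₁ * γ₂) :
    ∃ P : ℤ[X], P.Monic ∧ P.natDegree = 4 ∧ P.coeff 0 = 1 ∧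
      P.map (Int.castRingHom ℂ) = (.X - .C γ₁) * (.X - .C (star γ₁)) * (.X - .C γ₂) *
        (.X - .C (star γ₂)) := by
  have h' : ∀ z ∈ X.lattice, A.mulVec z ∈ X.lattice := fun z hz => (h z).mpr hz
  let T := latticeMap A h'
  -- The polynomial is identified by its values at integers: n − A preserves Λ too, so the
  -- determinant formula applies to it.
  have heval : ∀ n : ℤ, ((T.charpoly.eval n : ℤ) : ℝ) = ‖((n : ℂ) - γ₁) * (n - γ₂)‖ ^ 2 := by
    intro n
    have h1 : ∀ z ∈ X.lattice, ((n : ℂ) • (1 : Matrix (Fin 2) (Fin 2) ℂ) - A).mulVec z ∈ X.lattice := by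
      intro z hz
      rw [Matrix.sub_mulVec, Matrix.smul_mulVec, Matrix.one_mulVec, Int.cast_smul_eq_zsmul]
      exact X.lattice.sub_mem (X.lattice.smul_mem _ hz) (h' z hz)
    have h2 : algebraMap ℤ (Module.End ℤ X.lattice) n - T = latticeMap _ h1 := by
      ext z : 2
      show n • (z : Fin 2 → ℂ) - A.mulVec z = ((n : ℂ) • (1 : Matrix (Fin 2) (Fin 2) ℂ) - A).mulVec z
      rw [Matrix.sub_mulVec, Matrix.smul_mulVec, Matrix.one_mulVec, Int.cast_smul_eq_zsmul]
    rw [LinearMap.eval_charpoly, h2, det_latticeMap]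
    congr 2
    rw [Matrix.trace_fin_two] at htr
    rw [Matrix.det_fin_two] at hdet ⊢
    simp
    linear_combination hdet - n * htr
  refine ⟨T.charpoly, T.charpoly_monic, ?_, ?_, ?_⟩
  · rw [LinearMap.charpoly_natDegree, finrank_lattice]
  · have h3 := heval 0
    have h4 := norm_det_eq_one hA h
    rw [← Polynomial.coeff_zero_eq_eval_zero] at h3
    simp [← hdet, h4, -norm_mul] at h3
    simpa [← hdet, h4] using h3
  · refine Polynomial.eq_of_infinite_eval_eq _ _ (Set.Infinite.mono ?_
      (Set.infinite_range_of_injective (Int.cast_injective (α := ℂ))))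
    rintro _ ⟨n, rfl⟩
    show Polynomial.eval _ _ = Polynomial.eval _ _
    have h3 : (T.charpoly.map (Int.castRingHom ℂ)).eval (n : ℂ) = ((T.charpoly.eval n : ℤ) : ℂ) :=
      Polynomial.eval_intCast_map (Int.castRingHom ℂ) T.charpoly n
    have h4 : ((T.charpoly.eval n : ℤ) : ℂ) = (((T.charpoly.eval n : ℤ) : ℝ) : ℂ) := by push_cast; rfl
    rw [h3, h4, heval, Complex.ofReal_pow, ← Complex.mul_conj']
    simp only [Polynomial.eval_mul, Polynomial.eval_sub, Polynomial.eval_X, Polynomial.eval_C,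
      map_mul, map_sub, map_intCast, Complex.star_def]
    ring

end ComplexTorus

/-! ### Irreducibility of the quartic. -/

open Polynomial in
/-- A quartic integral polynomial with constant term one, all of whose roots satisfy
`|r| ^ 2 + |r| ^ (-2) = s`, is irreducible if neither `s + 2` nor `s - 2` is a square. -/
theorem Polynomial.Monic.irreducible_of_quartic {P : ℤ[X]} (hP : P.Monic) (hdeg : P.natDegree = 4)
    (h0 : P.coeff 0 = 1) {s : ℝ} (hs : s ≠ 2)
    (hroot : ∀ r : ℂ, aeval r P = 0 → ‖r‖ ^ 2 + (‖r‖ ^ 2)⁻¹ = s)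
    (hsq : ¬ ∃ k : ℤ, s + 2 = (k : ℝ) ^ 2 ∨ s - 2 = (k : ℝ) ^ 2) : Irreducible P := by
  rw [hP.irreducible_iff_natDegree']
  refine ⟨fun h => by simp [h] at hdeg, fun f g hf hg hfg hmem => ?_⟩
  rw [hdeg, Finset.mem_Ioc] at hmem
  have hε : g.coeff 0 = 1 ∨ g.coeff 0 = -1 := by
    refine Int.isUnit_iff.mp (IsUnit.of_mul_eq_one_right (f.coeff 0) ?_)
    rw [← mul_coeff_zero, hfg, h0]
  have hgdeg : (g.map (Int.castRingHom ℂ)).degree ≠ 0 := by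
    rw [hg.degree_map, Polynomial.degree_eq_natDegree hg.ne_zero]
    exact_mod_cast hmem.1.ne'
  obtain ⟨r, hr⟩ := IsAlgClosed.exists_root _ hgdeg
  rw [IsRoot, eval_map] at hr
  have hgr : aeval r g = 0 := hr
  have hrs := hroot r (by rw [← hfg, map_mul, hgr, mul_zero])
  -- The condition s ≠ 2 keeps the roots off the unit circle; this alone rules out linear factors,
  -- whose root would be ±1.
  have hne : ‖r‖ ^ 2 ≠ 1 := fun h => hs (by rw [← hrs, h]; norm_num)
  have hlead := hg.coeff_natDegree
  obtain hd | hd : g.natDegree = 1 ∨ g.natDegree = 2 := by omega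
  · rw [aeval_eq_sum_range, hd] at hgr
    rw [hd] at hlead
    simp [Finset.sum_range_succ, hlead] at hgr
    apply hne
    have : r = -(g.coeff 0 : ℂ) := by linear_combination hgr
    rw [this]
    rcases hε with h | h <;> simp [h]
  · rw [aeval_eq_sum_range, hd] at hgr
    rw [hd] at hlead
    simp [Finset.sum_range_succ, hlead] at hgr
    set k := g.coeff 1
    set ε := g.coeff 0
    have hε2 : (ε : ℝ) ^ 2 = 1 := by rcases hε with h | h <;> simp [h]
    have hre := congrArg Complex.re hgr
    have him := congrArg Complex.im hgr
    simp [sq] at hre him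
    have hn : ‖r‖ ^ 2 = r.re ^ 2 + r.im ^ 2 := by
      rw [Complex.sq_norm, Complex.normSq_apply]; ring
    -- A real root r of t² + kt + ε has partner ε / r, so k² = r² + r⁻² + 2ε = s + 2ε. A non-real
    -- root has its conjugate as partner, so |r|² = ε, which is impossible for either sign.
    by_cases hi : r.im = 0
    · rw [hi] at hre hn
      rw [hn] at hrs
      have hx : r.re ≠ 0 := by
        intro h
        rw [h] at hre
        simp at hre
        rw [hre] at hε2; norm_num at hε2
      have hk : (k : ℝ) ^ 2 = s + 2 * ε := by
        rw [← hrs]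
        have : (k : ℝ) = -(r.re + ε / r.re) := by field_simp; linear_combination hre
        rw [this]; field_simp
        linear_combination r.re ^ 2 * hε2
      apply hsq
      refine ⟨k, ?_⟩
      rw [hk]
      rcases hε with h | h
      · left; rw [h]; norm_num
      · right; rw [h]; norm_num; ring
    · have h1 : (k : ℝ) = -2 * r.re := by
        have : r.im * (2 * r.re + k) = 0 := by linear_combination him
        rcases mul_eq_zero.mp this with h | h
        · exact absurd h hi
        · linarith
      have h2 : r.re ^ 2 + r.im ^ 2 = ε := by rw [h1] at hre; linear_combination -hre
      rcases hε with h | h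
      · rw [h] at h2; apply hne; rw [hn, h2]; norm_num
      · rw [h] at h2; push_cast at h2; nlinarith [sq_nonneg r.re, sq_nonneg r.im]

/-! ### The rational span as a one-dimensional space over a quartic field. -/

namespace ComplexTorus

variable {X Y : ComplexTorus}

/-- The squared absolute values of the roots are λ and λ⁻¹, so |r|² + |r|⁻² has the same value λ +
λ⁻¹ > 2 at all of them. -/
theorem exists_irreducible_charpoly {A : Matrix (Fin 2) (Fin 2) ℂ} (hA : IsUnit A)
    (h : ∀ z, A.mulVec z ∈ X.lattice ↔ z ∈ X.lattice) {γ₁ γ₂ : ℂ}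
    (htr : A.trace = γ₁ + γ₂) (hdet : A.det = γ₁ * γ₂) {lam : ℝ} (hlam : 1 < lam)
    (hγ : ‖γ₁‖ ^ 2 = lam)
    (hsq : ¬ ∃ k : ℤ, lam + lam⁻¹ + 2 = (k : ℝ) ^ 2 ∨ lam + lam⁻¹ - 2 = (k : ℝ) ^ 2) :
    ∃ P : ℤ[X], P.Monic ∧ P.natDegree = 4 ∧ Irreducible P ∧
      P.map (Int.castRingHom ℂ) = (.X - .C γ₁) * (.X - .C (star γ₁)) * (.X - .C γ₂) *
        (.X - .C (star γ₂)) := by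
  obtain ⟨P, hP, hdeg, h0, hmap⟩ := exists_charpoly hA h htr hdet
  refine ⟨P, hP, hdeg, ?_, hmap⟩
  have hone : ‖γ₁‖ * ‖γ₂‖ = 1 := by
    rw [← norm_mul, ← hdet]; exact norm_det_eq_one hA h
  have hγ₂ : ‖γ₂‖ ^ 2 = lam⁻¹ := by
    rw [← hγ]
    refine eq_inv_of_mul_eq_one_right ?_
    rw [← mul_pow, hone, one_pow]
  refine hP.irreducible_of_quartic hdeg h0 (s := lam + lam⁻¹) ?_ (fun r hr => ?_) hsq
  · intro h2
    have : lam ≠ 0 := by positivity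
    field_simp at h2
    nlinarith [sq_nonneg (lam - 1)]
  · have h1 : (P.map (Int.castRingHom ℂ)).eval r = 0 := by
      rw [Polynomial.eval_map]; exact hr
    rw [hmap] at h1
    simp only [Polynomial.eval_mul, Polynomial.eval_sub, Polynomial.eval_X, Polynomial.eval_C,
      mul_eq_zero, sub_eq_zero] at h1
    rcases h1 with ((rfl | rfl) | rfl) | rfl
    · rw [hγ]
    · rw [norm_star, hγ]
    · rw [hγ₂, inv_inv, add_comm]
    · rw [norm_star, hγ₂, inv_inv, add_comm]

theorem minpoly_eq_of_irreducible {P : ℤ[X]} (hP : P.Monic) (hirr : Irreducible P) {γ : ℂ}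
    (h : Polynomial.aeval γ P = 0) : minpoly ℚ γ = P.map (algebraMap ℤ ℚ) := by
  refine (minpoly.eq_of_irreducible_of_monic
    ((hP.irreducible_iff_irreducible_map_fraction_map (K := ℚ)).mp hirr) ?_ (hP.map _)).symm
  rw [Polynomial.aeval_map_algebraMap, h]

theorem finrank_rationalSpan_le (X : ComplexTorus) :
    FiniteDimensional ℚ X.rationalSpan ∧ Module.finrank ℚ X.rationalSpan ≤ 4 := by
  have h : X.rationalSpan = Submodule.span ℚ (Set.range X.realBasis) := by
    rw [rationalSpan, ← span_realBasis, Submodule.span_span_of_tower]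
  rw [h]
  exact ⟨FiniteDimensional.span_of_finite ℚ (Set.finite_range _),
    (finrank_range_le_card _).trans (by simp)⟩

theorem mulVec_mem_rationalSpan {A : Matrix (Fin 2) (Fin 2) ℂ}
    (hA : ∀ z ∈ X.lattice, A.mulVec z ∈ X.lattice) {z : Fin 2 → ℂ} (hz : z ∈ X.rationalSpan) :
    A.mulVec z ∈ X.rationalSpan := by
  have : X.rationalSpan ≤ X.rationalSpan.comap (A.mulVecLin.restrictScalars ℚ) :=
    Submodule.span_le.mpr fun w hw => lattice_le_rationalSpan (hA w hw)
  exact this hz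

/-- A diagonal matrix with irreducible characteristic polynomial on the lattice makes the rational
span a one-dimensional space over the field generated by an eigenvalue. -/
theorem rationalSpan_eq_span_pow {γ₁ γ₂ : ℂ}
    (hG : ∀ z ∈ X.lattice, (Matrix.diagonal ![γ₁, γ₂]).mulVec z ∈ X.lattice)
    (h₁ : (minpoly ℚ γ₁).natDegree = 4) (h₂ : (minpoly ℚ γ₂).natDegree = 4) {v : Fin 2 → ℂ}
    (hv : v ∈ X.rationalSpan) (hv0 : v ≠ 0) :
    X.rationalSpan =
      Submodule.span ℚ (Set.range fun i : Fin 4 => ![γ₁ ^ (i : ℕ) * v 0, γ₂ ^ (i : ℕ) * v 1]) := by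
  obtain ⟨hfin, hrank⟩ := finrank_rationalSpan_le X
  have hle : Submodule.span ℚ
      (Set.range fun i : Fin 4 => ![γ₁ ^ (i : ℕ) * v 0, γ₂ ^ (i : ℕ) * v 1]) ≤ X.rationalSpan := by
    rw [Submodule.span_le]
    rintro _ ⟨i, rfl⟩
    have : ∀ n : ℕ, ![γ₁ ^ n * v 0, γ₂ ^ n * v 1] ∈ X.rationalSpan := by
      intro n
      induction n with
      | zero =>
        convert hv using 1
        ext j; fin_cases j <;> simp
      | succ n ih =>
        convert mulVec_mem_rationalSpan hG ih using 1
        ext j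
        rw [Matrix.mulVec_diagonal]
        fin_cases j <;> simp [pow_succ'] <;> ring
    exact this i
  have hpow : ∀ γ : ℂ, (minpoly ℚ γ).natDegree = 4 →
      LinearIndependent ℚ fun i : Fin 4 => γ ^ (i : ℕ) := fun γ hγ => hγ ▸ linearIndependent_pow γ
  have hli : LinearIndependent ℚ
      fun i : Fin 4 => ![γ₁ ^ (i : ℕ) * v 0, γ₂ ^ (i : ℕ) * v 1] := by
    -- Independence is tested in a coordinate where v does not vanish; there it is the independence
    -- of 1, γ, γ², γ³.
    by_cases h0 : v 0 = 0
    · have h1 : v 1 ≠ 0 := fun h1 => hv0 (by ext j; fin_cases j <;> simp [h0, h1])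
      let L := (LinearMap.mulRight ℚ (v 1)⁻¹).comp (LinearMap.proj (R := ℚ) (φ := fun _ : Fin 2 => ℂ) 1)
      have hL : (fun i : Fin 4 => γ₂ ^ (i : ℕ)) =
          L ∘ fun i : Fin 4 => ![γ₁ ^ (i : ℕ) * v 0, γ₂ ^ (i : ℕ) * v 1] := by
        ext i
        simp [L, h1]
      exact LinearIndependent.of_comp L (hL ▸ hpow γ₂ h₂)
    · let L := (LinearMap.mulRight ℚ (v 0)⁻¹).comp (LinearMap.proj (R := ℚ) (φ := fun _ : Fin 2 => ℂ) 0)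
      have hL : (fun i : Fin 4 => γ₁ ^ (i : ℕ)) =
          L ∘ fun i : Fin 4 => ![γ₁ ^ (i : ℕ) * v 0, γ₂ ^ (i : ℕ) * v 1] := by
        ext i
        simp [L, h0]
      exact LinearIndependent.of_comp L (hL ▸ hpow γ₁ h₁)
  refine (Submodule.eq_of_le_of_finrank_le hle ?_).symm
  rw [finrank_span_eq_card hli]
  simpa using hrank

/-- If v j vanished, Λ would lie in the proper real subspace z j = 0 and could not span ℂ². -/
theorem ne_zero_of_rationalSpan_eq {γ₁ γ₂ : ℂ} {v : Fin 2 → ℂ}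
    (h : X.rationalSpan =
      Submodule.span ℚ (Set.range fun i : Fin 4 => ![γ₁ ^ (i : ℕ) * v 0, γ₂ ^ (i : ℕ) * v 1]))
    (j : Fin 2) : v j ≠ 0 := by
  intro h0
  have hle : Submodule.span ℝ (X.lattice : Set (Fin 2 → ℂ)) ≤
      LinearMap.ker (LinearMap.proj (R := ℝ) (φ := fun _ : Fin 2 => ℂ) j) := by
    rw [Submodule.span_le]
    intro z hz
    have hz' : z ∈ X.rationalSpan := lattice_le_rationalSpan hz
    have : X.rationalSpan ≤ LinearMap.ker (LinearMap.proj (R := ℚ) (φ := fun _ : Fin 2 => ℂ) j) := by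
      rw [h, Submodule.span_le]
      rintro _ ⟨i, rfl⟩
      fin_cases j <;> simp_all
    exact this hz'
  rw [X.span_eq_top] at hle
  have : (Pi.single j 1 : Fin 2 → ℂ) ∈
      LinearMap.ker (LinearMap.proj (R := ℝ) (φ := fun _ : Fin 2 => ℂ) j) := hle trivial
  simp at this

/-- Lattices preserved by the same diagonal matrix, with irreducible characteristic polynomial, have
rational spans that correspond under an invertible diagonal matrix. -/
theorem exists_diagonal_rationalSpan {γ₁ γ₂ : ℂ}
    (hX : ∀ z ∈ X.lattice, (Matrix.diagonal ![γ₁, γ₂]).mulVec z ∈ X.lattice)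
    (hY : ∀ z ∈ Y.lattice, (Matrix.diagonal ![γ₁, γ₂]).mulVec z ∈ Y.lattice)
    (h₁ : (minpoly ℚ γ₁).natDegree = 4) (h₂ : (minpoly ℚ γ₂).natDegree = 4) :
    ∃ d : Fin 2 → ℂ, IsUnit (Matrix.diagonal d) ∧
      ∀ z, (Matrix.diagonal d).mulVec z ∈ Y.rationalSpan ↔ z ∈ X.rationalSpan := by
  have hmem : ∀ Z : ComplexTorus, ∃ v ∈ Z.rationalSpan, v ≠ 0 := fun Z =>
    ⟨Z.realBasis 0, lattice_le_rationalSpan (by rw [realBasis_apply]; exact (Z.latticeBasis 0).2),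
      Z.realBasis.ne_zero 0⟩
  obtain ⟨v, hv, hv0⟩ := hmem X
  obtain ⟨w, hw, hw0⟩ := hmem Y
  have hXs := rationalSpan_eq_span_pow hX h₁ h₂ hv hv0
  have hYs := rationalSpan_eq_span_pow hY h₁ h₂ hw hw0
  have hvj := ne_zero_of_rationalSpan_eq hXs
  have hwj := ne_zero_of_rationalSpan_eq hYs
  -- The coordinatewise ratio w / v carries the rational basis generated from v to the one generated
  -- from w.
  have hunit : IsUnit (Matrix.diagonal fun j => w j / v j) := by
    rw [Matrix.isUnit_iff_isUnit_det, Matrix.det_diagonal, isUnit_iff_ne_zero,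
      Finset.prod_ne_zero_iff]
    exact fun j _ => div_ne_zero (hwj j) (hvj j)
  refine ⟨fun j => w j / v j, hunit, fun z => ?_⟩
  have hmap : Y.rationalSpan =
      X.rationalSpan.map ((Matrix.diagonal fun j => w j / v j).mulVecLin.restrictScalars ℚ) := by
    rw [hXs, hYs, Submodule.map_span, ← Set.range_comp]
    congr 2
    ext i j
    have e0 := hvj 0
    have e1 := hvj 1
    simp only [Function.comp_apply, LinearMap.restrictScalars_apply, Matrix.mulVecLin_apply,
      Matrix.mulVec_diagonal]
    fin_cases j <;> simp <;> field_simp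
  rw [hmap]
  constructor
  · rintro ⟨y, hy, hyz⟩
    rwa [← (mulVec_bijective hunit).1 hyz]
  · exact fun hz => ⟨z, hz, rfl⟩

end ComplexTorus

/-! ### The sextic of the exterior square. -/

open Polynomial in
-- The characteristic polynomial of an exterior square, in the elementary symmetric functions of the
-- eigenvalues. The products are listed so that x, y = γ₁, γ̄₁ and z, w = γ₂, γ̄₂ give the order
-- used in `eigenvaluePairs`.
theorem prod_X_sub_C_products (x y z w : ℂ) :
    (({x * z, x * y, x * w, z * y, z * w, y * w} : Multiset ℂ).map fun a => X - C a).prod =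
    X ^ 6 - C (x * y + x * z + x * w + y * z + y * w + z * w) * X ^ 5 +
      C ((x + y + z + w) * (x * y * z + x * y * w + x * z * w + y * z * w) - x * y * z * w) * X ^ 4 -
      C ((x + y + z + w) ^ 2 * (x * y * z * w) +
        (x * y * z + x * y * w + x * z * w + y * z * w) ^ 2 -
        2 * (x * y + x * z + x * w + y * z + y * w + z * w) * (x * y * z * w)) * X ^ 3 +
      C ((x + y + z + w) * (x * y * z + x * y * w + x * z * w + y * z * w) * (x * y * z * w) -
        (x * y * z * w) ^ 2) * X ^ 2 -
      C ((x * y + x * z + x * w + y * z + y * w + z * w) * (x * y * z * w) ^ 2) * X +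
      C ((x * y * z * w) ^ 3) := by
  simp only [Multiset.insert_eq_cons, Multiset.map_cons, Multiset.map_singleton,
    Multiset.prod_cons, Multiset.prod_singleton, map_mul, map_add, map_sub, map_pow, map_ofNat]
  ring

open Polynomial in
theorem degree_sextic_tail (p q r : ℤ) :
    (C p * X ^ 5 + C q * X ^ 4 + C r * X ^ 3 + C q * X ^ 2 + C p * X + 1 : ℤ[X]).degree <
      (6 : ℕ) := by
  refine (degree_lt_iff_coeff_zero _ 6).mpr fun n hn => ?_
  simp only [coeff_add, coeff_C_mul, coeff_X_pow, coeff_X, coeff_one]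
  rw [if_neg (by omega), if_neg (by omega), if_neg (by omega), if_neg (by omega),
    if_neg (by omega), if_neg (by omega)]
  simp

open Polynomial in
theorem natDegree_sextic (p q r : ℤ) :
    (X ^ 6 + C p * X ^ 5 + C q * X ^ 4 + C r * X ^ 3 + C q * X ^ 2 + C p * X + 1 :
      ℤ[X]).natDegree = 6 := by
  have := natDegree_add_eq_left_of_degree_lt
    ((degree_sextic_tail p q r).trans_eq (degree_X_pow (R := ℤ) 6).symm)
  rw [natDegree_X_pow] at this
  simpa only [← add_assoc] using this

open Polynomial in
theorem monic_sextic (p q r : ℤ) :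
    (X ^ 6 + C p * X ^ 5 + C q * X ^ 4 + C r * X ^ 3 + C q * X ^ 2 + C p * X + 1 :
      ℤ[X]).Monic := by
  have := monic_X_pow_add (degree_sextic_tail p q r)
  simpa only [← add_assoc] using this

open Polynomial in
theorem reverse_sextic (p q r : ℤ) :
    (X ^ 6 + C p * X ^ 5 + C q * X ^ 4 + C r * X ^ 3 + C q * X ^ 2 + C p * X + 1 : ℤ[X]).reverse =
      X ^ 6 + C p * X ^ 5 + C q * X ^ 4 + C r * X ^ 3 + C q * X ^ 2 + C p * X + 1 := by
  have h1 : ∀ n, n ≤ 6 → reflect 6 (X ^ n : ℤ[X]) = X ^ (6 - n) := fun n hn => by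
    rw [reflect_monomial, revAt_le hn]
  have h2 : reflect 6 (X : ℤ[X]) = X ^ 5 := by simpa using h1 1 (by norm_num)
  have h3 : reflect 6 (1 : ℤ[X]) = X ^ 6 := by simp
  rw [reverse, natDegree_sextic]
  simp only [reflect_add, reflect_C_mul, h1, h2, h3, le_refl, Nat.reduceLeDiff, Nat.reduceSub,
    pow_zero, pow_one]
  ring

open Polynomial in
theorem coeff_quartic (e₁ e₂ e₃ e₄ : ℂ) :
    (X ^ 4 - C e₁ * X ^ 3 + C e₂ * X ^ 2 - C e₃ * X + C e₄ : ℂ[X]).coeff 3 = -e₁ ∧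
      (X ^ 4 - C e₁ * X ^ 3 + C e₂ * X ^ 2 - C e₃ * X + C e₄ : ℂ[X]).coeff 2 = e₂ ∧
      (X ^ 4 - C e₁ * X ^ 3 + C e₂ * X ^ 2 - C e₃ * X + C e₄ : ℂ[X]).coeff 1 = -e₃ := by
  simp only [coeff_add, coeff_sub, coeff_C_mul, coeff_X_pow, coeff_X, coeff_C]
  norm_num

/-- The eigenvalues of an automorphism with irreducible characteristic polynomial. -/
theorem mem_eigenvaluePairs {γ₁ γ₂ : ℂ} {P : ℤ[X]} (hP : P.Monic) (hdeg : P.natDegree = 4)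
    (hirr : Irreducible P)
    (hmap : P.map (Int.castRingHom ℂ) = (.X - .C γ₁) * (.X - .C (star γ₁)) * (.X - .C γ₂) *
        (.X - .C (star γ₂)))
    {lam : ℝ} (hlam : 1 < lam) (hγ : ‖γ₁‖ ^ 2 = lam) (hone : ‖γ₁ * γ₂‖ = 1) :
    (γ₁, γ₂) ∈ eigenvaluePairs lam := by
  have hroot : ∀ r : ℂ, Polynomial.aeval r P = (r - γ₁) * (r - star γ₁) * (r - γ₂) *
      (r - star γ₂) := by
    intro r
    have : Polynomial.aeval r P = (P.map (Int.castRingHom ℂ)).eval r := by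
      rw [Polynomial.eval_map]; rfl
    rw [this, hmap]; simp
  have hr₁ : Polynomial.aeval γ₁ P = 0 := by rw [hroot]; ring
  have hr₂ : Polynomial.aeval γ₂ P = 0 := by rw [hroot]; ring
  have hm₁ := ComplexTorus.minpoly_eq_of_irreducible hP hirr hr₁
  have hm₂ := ComplexTorus.minpoly_eq_of_irreducible hP hirr hr₂
  have hone' : ‖γ₁‖ * ‖γ₂‖ = 1 := by rw [← norm_mul, hone]
  have h1 : 1 < ‖γ₁‖ := by nlinarith [norm_nonneg γ₁]
  have h2 : ‖γ₂‖ < 1 := by nlinarith [norm_nonneg γ₂]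
  have hγ₂ : ‖γ₂‖ ^ 2 = lam⁻¹ := by
    rw [← hγ]
    refine eq_inv_of_mul_eq_one_right ?_
    rw [← mul_pow, hone', one_pow]
  have hs₁ : γ₁ * star γ₁ = lam := by
    rw [← hγ, Complex.star_def, Complex.mul_conj']; norm_cast
  have hs₂ : γ₂ * star γ₂ = (lam⁻¹ : ℝ) := by
    rw [← hγ₂, Complex.star_def, Complex.mul_conj']; norm_cast
  have he4 : γ₁ * star γ₁ * γ₂ * star γ₂ = 1 := by
    rw [mul_assoc, hs₁, hs₂, ← Complex.ofReal_mul, mul_inv_cancel₀ (by positivity),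
      Complex.ofReal_one]
  -- the coefficients of the characteristic polynomial
  have hexp : P.map (Int.castRingHom ℂ) = .X ^ 4 -
      .C (γ₁ + star γ₁ + γ₂ + star γ₂) * .X ^ 3 +
      .C (γ₁ * star γ₁ + γ₁ * γ₂ + γ₁ * star γ₂ + star γ₁ * γ₂ + star γ₁ * star γ₂ +
        γ₂ * star γ₂) * .X ^ 2 -
      .C (γ₁ * star γ₁ * γ₂ + γ₁ * star γ₁ * star γ₂ + γ₁ * γ₂ * star γ₂ +
        star γ₁ * γ₂ * star γ₂) * .X + .C (γ₁ * star γ₁ * γ₂ * star γ₂) := by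
    rw [hmap]
    simp only [map_mul, map_add]
    ring
  have hcoeff : ∀ n, ((P.coeff n : ℤ) : ℂ) = (P.map (Int.castRingHom ℂ)).coeff n := fun n => by
    rw [Polynomial.coeff_map]; rfl
  obtain ⟨a, ha⟩ : ∃ a : ℤ, (a : ℂ) = -(γ₁ + star γ₁ + γ₂ + star γ₂) :=
    ⟨P.coeff 3, by rw [hcoeff, hexp]; exact (coeff_quartic _ _ _ _).1⟩
  obtain ⟨b, hb⟩ : ∃ b : ℤ, (b : ℂ) = γ₁ * star γ₁ + γ₁ * γ₂ + γ₁ * star γ₂ + star γ₁ * γ₂ +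
      star γ₁ * star γ₂ + γ₂ * star γ₂ :=
    ⟨P.coeff 2, by rw [hcoeff, hexp]; exact (coeff_quartic _ _ _ _).2.1⟩
  obtain ⟨c, hc⟩ : ∃ c : ℤ, (c : ℂ) = -(γ₁ * star γ₁ * γ₂ + γ₁ * star γ₁ * star γ₂ +
      γ₁ * γ₂ * star γ₂ + star γ₁ * γ₂ * star γ₂) :=
    ⟨P.coeff 1, by rw [hcoeff, hexp]; exact (coeff_quartic _ _ _ _).2.2⟩
  -- Here P = t⁴ + at³ + bt² + ct + 1. Constant term 1 makes Q reciprocal, with Q(1) = −(a − c)² and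
  -- Q(−1) = (a + c)².
  let Q : ℤ[X] := .X ^ 6 + .C (-b) * .X ^ 5 + .C (a * c - 1) * .X ^ 4 +
    .C (2 * b - a ^ 2 - c ^ 2) * .X ^ 3 + .C (a * c - 1) * .X ^ 2 + .C (-b) * .X + 1
  have hQdeg : Q.natDegree = 6 := natDegree_sextic _ _ _
  have hQmonic : Q.Monic := monic_sextic _ _ _
  have hQmap : Q.map (Int.castRingHom ℂ) = (({γ₁ * γ₂, γ₁ * star γ₁, γ₁ * star γ₂,
      γ₂ * star γ₁, γ₂ * star γ₂, star γ₁ * star γ₂} : Multiset ℂ).map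
        fun z => Polynomial.X - Polynomial.C z).prod := by
    rw [prod_X_sub_C_products γ₁ (star γ₁) γ₂ (star γ₂), he4, ← hb, eq_neg_iff_add_eq_zero.mp ha
      |> eq_neg_of_add_eq_zero_right, eq_neg_iff_add_eq_zero.mp hc |> eq_neg_of_add_eq_zero_right]
    have hcast : ∀ n : ℤ, Int.castRingHom ℂ n = n := fun _ => rfl
    simp only [Q, Polynomial.map_add, Polynomial.map_mul, Polynomial.map_pow, Polynomial.map_X,
      Polynomial.map_C, Polynomial.map_one]
    simp only [hcast, Int.cast_neg, Int.cast_sub, Int.cast_mul,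
      Int.cast_pow, Int.cast_one, Int.cast_ofNat, one_pow, mul_one, Polynomial.C_1,
      Polynomial.C_neg, Polynomial.C_sub, Polynomial.C_add, Polynomial.C_mul, Polynomial.C_pow]
    ring
  have hQroots := congrArg Polynomial.roots hQmap
  rw [Polynomial.roots_multiset_prod_X_sub_C] at hQroots
  have hint : IsIntegral ℤ γ₁ := ⟨P, hP, hr₁⟩
  have hQrev : Q.reverse = Q := reverse_sextic (-b) (a * c - 1) (2 * b - a ^ 2 - c ^ 2)
  have hQ1 : Q.eval 1 = 2 * a * c - a ^ 2 - c ^ 2 := by simp [Q]; ring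
  have hQ2 : Q.eval (-1) = (a + c) ^ 2 := by simp [Q]; ring
  clear_value Q
  refine ⟨hint, ?_, ?_, ?_, hone, Q, hQmonic, hQdeg, hQrev, ?_, hQroots, ?_,
    a - c, a + c, ?_, ?_⟩
  · rw [hm₁, hP.natDegree_map, hdeg]
  · rw [hm₁, hm₂]
  · linarith
  · have hQlam : Polynomial.aeval lam Q = 0 := by
      have h3 : Polynomial.aeval (lam : ℂ) Q = 0 := by
        have : (lam : ℂ) ∈ (Q.map (Int.castRingHom ℂ)).roots := by
          rw [hQroots, ← hs₁]; simp
        have h4 := Polynomial.isRoot_of_mem_roots this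
        rw [Polynomial.IsRoot, Polynomial.eval_map] at h4
        exact h4
      have h5 : Polynomial.aeval (algebraMap ℝ ℂ lam) Q =
        algebraMap ℝ ℂ (Polynomial.aeval lam Q) := Polynomial.aeval_algebraMap_apply ℂ lam Q
      have h6 : algebraMap ℝ ℂ (Polynomial.aeval lam Q) = 0 := by rw [← h5]; exact h3
      simpa using h6
    exact minpoly.isIntegrallyClosed_dvd ⟨Q, hQmonic, hQlam⟩ hQlam
  · have hl1 : (1 : ℝ) ≠ lam := by linarith
    have hl2 : (1 : ℝ) ≠ lam⁻¹ := by
      intro h; rw [eq_comm, inv_eq_one] at h; linarith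
    have hone'' : ‖γ₂‖ * ‖γ₁‖ = 1 := by rw [mul_comm]; exact hone'
    rw [hQroots]
    simp only [Multiset.insert_eq_cons, Multiset.map_cons, Multiset.map_singleton, norm_mul,
      norm_star, hone', hone'', ← sq, hγ, hγ₂]
    simp [hl1, hl2]
  · rw [hQ1]; ring
  · rw [hQ2]

/-! ### From tori to eigenvalue pairs. -/

namespace ComplexTorus

variable {X Y : ComplexTorus}

/-- The image of a torus under a linear change of coordinates of `ℂ²`. -/
noncomputable def mapLinear (X : ComplexTorus) {S : Matrix (Fin 2) (Fin 2) ℂ} (hS : IsUnit S) :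
    ComplexTorus :=
  ofBasis (X.realBasis.map
    (LinearEquiv.ofBijective (S.mulVecLin.restrictScalars ℝ) (mulVec_bijective hS)))

theorem mapLinear_lattice {S : Matrix (Fin 2) (Fin 2) ℂ} (hS : IsUnit S) :
    (X.mapLinear hS).lattice = X.lattice.map (mulVecInt S) := by
  rw [← X.span_realBasis, Submodule.map_span, ← Set.range_comp]
  rfl

theorem mulVec_mem_mapLinear_lattice {S : Matrix (Fin 2) (Fin 2) ℂ} (hS : IsUnit S)
    {z : Fin 2 → ℂ} : S.mulVec z ∈ (X.mapLinear hS).lattice ↔ z ∈ X.lattice := by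
  rw [mapLinear_lattice]
  constructor
  · rintro ⟨w, hw, h⟩
    rwa [← (mulVec_bijective hS).1 h]
  · exact fun h => ⟨z, h, rfl⟩

theorem mulVec_mem_mapLinear_rationalSpan {S : Matrix (Fin 2) (Fin 2) ℂ} (hS : IsUnit S)
    {z : Fin 2 → ℂ} : S.mulVec z ∈ (X.mapLinear hS).rationalSpan ↔ z ∈ X.rationalSpan := by
  have : (X.mapLinear hS).rationalSpan = X.rationalSpan.map (S.mulVecLin.restrictScalars ℚ) := by
    rw [rationalSpan, rationalSpan, mapLinear_lattice, Submodule.map_span]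
    rfl
  rw [this]
  constructor
  · rintro ⟨w, hw, h⟩
    rwa [← (mulVec_bijective hS).1 h]
  · exact fun h => ⟨z, h, rfl⟩

theorem exists_eigenvalues (A : Matrix (Fin 2) (Fin 2) ℂ) :
    ∃ γ₁ γ₂ : ℂ, A.trace = γ₁ + γ₂ ∧ A.det = γ₁ * γ₂ ∧ ‖γ₂‖ ≤ ‖γ₁‖ := by
  obtain ⟨d, hd⟩ := IsAlgClosed.exists_pow_nat_eq (A.trace ^ 2 - 4 * A.det) two_pos
  rcases le_total ‖(A.trace - d) / 2‖ ‖(A.trace + d) / 2‖ with h | h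
  · exact ⟨_, _, by ring, by linear_combination hd / 4, h⟩
  · exact ⟨_, _, by ring, by linear_combination hd / 4, h⟩

theorem AdmitsEntropy.exists_eigenvalues {lam : ℝ} (hlam : 1 < lam)
    (h : X.AdmitsEntropy (Real.log lam)) :
    ∃ (A : Matrix (Fin 2) (Fin 2) ℂ) (γ₁ γ₂ : ℂ), IsUnit A ∧
      (∀ z, A.mulVec z ∈ X.lattice ↔ z ∈ X.lattice) ∧ A.trace = γ₁ + γ₂ ∧ A.det = γ₁ * γ₂ ∧
      ‖γ₁‖ ^ 2 = lam ∧ ‖γ₁ * γ₂‖ = 1 := by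
  obtain ⟨f, hf, hent⟩ := h
  obtain ⟨A, b, hfA, hA, hlat⟩ := hf.exists_affine
  obtain ⟨γ₁, γ₂, htr, hdet, hle⟩ := ComplexTorus.exists_eigenvalues A
  have hone : ‖γ₁ * γ₂‖ = 1 := hdet ▸ norm_det_eq_one hA hlat
  refine ⟨A, γ₁, γ₂, hA, hlat, htr, hdet, ?_, hone⟩
  rw [coverEntropy_eq hfA htr hdet hle hone, EReal.coe_eq_coe_iff] at hent
  have hpos : 0 < ‖γ₁‖ := by
    refine norm_pos_iff.mpr fun h0 => ?_
    simp [h0] at hone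
  exact Real.log_injOn_pos (Set.mem_Ioi.mpr (by positivity)) (Set.mem_Ioi.mpr (by linarith)) hent

/-- `γ` is a pair of eigenvalues of an endomorphism of the lattice, which is diagonalizable. -/
def HasEigenvaluePair (X : ComplexTorus) (γ : ℂ × ℂ) : Prop :=
  ∃ S : Matrix (Fin 2) (Fin 2) ℂ, ∃ hS : IsUnit S,
    ∀ z ∈ (X.mapLinear hS).lattice,
      (Matrix.diagonal ![γ.1, γ.2]).mulVec z ∈ (X.mapLinear hS).lattice

/-- The eigenvalues have different absolute values, so A is diagonalizable, and S⁻¹ moves the torus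
into eigencoordinates. -/
theorem AdmitsEntropy.exists_hasEigenvaluePair {lam : ℝ} (hlam : 1 < lam)
    (h : X.AdmitsEntropy (Real.log lam))
    (hsq : ¬ ∃ k : ℤ, lam + lam⁻¹ + 2 = (k : ℝ) ^ 2 ∨ lam + lam⁻¹ - 2 = (k : ℝ) ^ 2) :
    ∃ γ ∈ eigenvaluePairs lam, X.HasEigenvaluePair γ := by
  obtain ⟨A, γ₁, γ₂, hA, hlat, htr, hdet, hγ, hone⟩ := h.exists_eigenvalues hlam
  obtain ⟨P, hP, hdeg, hirr, hmap⟩ := exists_irreducible_charpoly hA hlat htr hdet hlam hγ hsq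
  have hmem := mem_eigenvaluePairs hP hdeg hirr hmap hlam hγ hone
  refine ⟨(γ₁, γ₂), hmem, ?_⟩
  have hne : γ₁ ≠ γ₂ := fun h => by
    have : ‖γ₂‖ < ‖γ₁‖ := hmem.2.2.2.1
    rw [h] at this; exact lt_irrefl _ this
  obtain ⟨S, hS, hAS⟩ := Matrix.exists_diagonalization_fin_two htr hdet hne
  have hSdet := (Matrix.isUnit_iff_isUnit_det _).mp hS
  have hS' : IsUnit S⁻¹ := Matrix.isUnit_nonsing_inv_iff.mpr hS
  refine ⟨S⁻¹, hS', fun z hz => ?_⟩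
  obtain ⟨w, rfl⟩ := (mulVec_bijective hS').2 z
  rw [mulVec_mem_mapLinear_lattice] at hz
  have : (Matrix.diagonal ![γ₁, γ₂]).mulVec (S⁻¹.mulVec w) = S⁻¹.mulVec (A.mulVec w) := by
    rw [Matrix.mulVec_mulVec, Matrix.mulVec_mulVec]
    congr 1
    calc Matrix.diagonal ![γ₁, γ₂] * S⁻¹ = S⁻¹ * (S * Matrix.diagonal ![γ₁, γ₂]) * S⁻¹ := by
          rw [← mul_assoc S⁻¹, Matrix.nonsing_inv_mul _ hSdet, one_mul]
      _ = S⁻¹ * A := by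
          rw [← hAS, mul_assoc, mul_assoc, Matrix.mul_nonsing_inv _ hSdet, mul_one]
  rw [this, mulVec_mem_mapLinear_lattice]
  exact (hlat w).mpr hz

/-- In eigencoordinates on both sides, the rational spans correspond under a diagonal matrix. -/
theorem isogenyClass_eq_of_hasEigenvaluePair {lam : ℝ} {γ : ℂ × ℂ} (hγ : γ ∈ eigenvaluePairs lam)
    (hX : X.HasEigenvaluePair γ) (hY : Y.HasEigenvaluePair γ) :
    isogenyClass X = isogenyClass Y := by
  obtain ⟨S, hS, hX⟩ := hX
  obtain ⟨T, hT, hY⟩ := hY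
  obtain ⟨d, hd, hdiag⟩ := exists_diagonal_rationalSpan hX hY hγ.2.1 (hγ.2.2.1 ▸ hγ.2.1)
  rw [isogenyClass_eq_of_rationalSpan hS fun z => mulVec_mem_mapLinear_rationalSpan (X := X) hS,
    isogenyClass_eq_of_rationalSpan hT fun z => mulVec_mem_mapLinear_rationalSpan (X := Y) hT,
    isogenyClass_eq_of_rationalSpan hd hdiag]

/-- The isogeny classes of the tori with an automorphism of given entropy are determined by the
eigenvalues. -/
theorem encard_isogenyClass_le {lam : ℝ} (hlam : 1 < lam)
    (hsq : ¬ ∃ k : ℤ, lam + lam⁻¹ + 2 = (k : ℝ) ^ 2 ∨ lam + lam⁻¹ - 2 = (k : ℝ) ^ 2) :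
    (isogenyClass '' {X | X.AdmitsEntropy (Real.log lam)}).encard ≤
      (eigenvaluePairs lam).encard := by
  classical
  -- Each pair is sent to the class of a chosen torus realizing it; the value ∅ at unrealized pairs
  -- is irrelevant.
  refine (Set.encard_le_encard (t := (fun γ => if h : ∃ X : ComplexTorus, X.HasEigenvaluePair γ
    then isogenyClass h.choose else ∅) '' eigenvaluePairs lam) ?_).trans (Set.encard_image_le _ _)
  rintro _ ⟨X, hX, rfl⟩
  obtain ⟨γ, hγ, hXγ⟩ := AdmitsEntropy.exists_hasEigenvaluePair hlam hX hsq
  refine ⟨γ, hγ, ?_⟩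
  have h : ∃ X : ComplexTorus, X.HasEigenvaluePair γ := ⟨X, hXγ⟩
  simp only [h, ↓reduceDIte]
  exact isogenyClass_eq_of_hasEigenvaluePair hγ h.choose_spec hXγ

/-- The range of A contains Λ, hence its real span ℂ². -/
theorem isUnit_of_image_lattice {A : Matrix (Fin 2) (Fin 2) ℂ}
    (h : (fun z => A.mulVec z) '' (X.lattice : Set (Fin 2 → ℂ)) = X.lattice) : IsUnit A := by
  rw [← Matrix.mulVec_surjective_iff_isUnit]
  have hle : Submodule.span ℝ (X.lattice : Set (Fin 2 → ℂ)) ≤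
      LinearMap.range (A.mulVecLin.restrictScalars ℝ) := by
    rw [Submodule.span_le, ← h]
    rintro _ ⟨z, -, rfl⟩
    exact ⟨z, rfl⟩
  rw [X.span_eq_top] at hle
  exact fun w => hle (Submodule.mem_top (x := w))

theorem mulVec_mem_lattice_iff_of_image {A : Matrix (Fin 2) (Fin 2) ℂ}
    (h : (fun z => A.mulVec z) '' (X.lattice : Set (Fin 2 → ℂ)) = X.lattice) (z : Fin 2 → ℂ) :
    A.mulVec z ∈ X.lattice ↔ z ∈ X.lattice := by
  rw [← SetLike.mem_coe, ← h]
  exact (mulVec_bijective (isUnit_of_image_lattice h)).1.mem_set_image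

/-- Two lattices preserved by a diagonal matrix with an eigenvalue of absolute value the square root
of `lam` are related by an isogeny that commutes with the matrix. -/
theorem exists_isogeny_commuting {lam : ℝ} (hlam : 1 < lam)
    (hsq : ¬ ∃ k : ℤ, lam + lam⁻¹ + 2 = (k : ℝ) ^ 2 ∨ lam + lam⁻¹ - 2 = (k : ℝ) ^ 2)
    (γ₁ γ₂ : ℂ) (G : Matrix (Fin 2) (Fin 2) ℂ) (hG : G = Matrix.diagonal ![γ₁, γ₂])
    (hγ : ‖γ₁‖ ^ 2 = lam) (X₁ X₂ : ComplexTorus)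
    (h₁ : (fun z => G.mulVec z) '' (X₁.lattice : Set (Fin 2 → ℂ)) = X₁.lattice)
    (h₂ : (fun z => G.mulVec z) '' (X₂.lattice : Set (Fin 2 → ℂ)) = X₂.lattice) :
    (∃ B : X₁.rationalSpan ≃ₗ[ℚ] X₂.rationalSpan, ∀ x y : X₁.rationalSpan,
      (y : Fin 2 → ℂ) = G.mulVec x → (B y : Fin 2 → ℂ) = G.mulVec (B x)) ∧
    ∃ Φ : GL (Fin 2) ℂ, Φ.val * G = G * Φ.val ∧
      (fun z => Φ.val.mulVec z) '' (X₁.rationalSpan : Set (Fin 2 → ℂ)) = X₂.rationalSpan ∧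
      ∃ (n : ℤ) (f : X₁.Carrier →+ X₂.Carrier), n ≠ 0 ∧ IsIsogeny f ∧
        ∀ z, f (X₁.proj z) = X₂.proj (n • Φ.val.mulVec z) := by
  have hA := isUnit_of_image_lattice h₁
  have hlat₁ := mulVec_mem_lattice_iff_of_image h₁
  have hlat₂ := mulVec_mem_lattice_iff_of_image h₂
  have htr : G.trace = γ₁ + γ₂ := by rw [hG, Matrix.trace_fin_two]; simp
  have hdet : G.det = γ₁ * γ₂ := by rw [hG, Matrix.det_fin_two]; simp
  obtain ⟨P, hP, hdeg, hirr, hmap⟩ := exists_irreducible_charpoly hA hlat₁ htr hdet hlam hγ hsq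
  have hmem : (γ₁, γ₂) ∈ eigenvaluePairs lam :=
    mem_eigenvaluePairs hP hdeg hirr hmap hlam hγ (hdet ▸ norm_det_eq_one hA hlat₁)
  subst hG
  obtain ⟨d, hd, hdiag⟩ := exists_diagonal_rationalSpan (fun z hz => (hlat₁ z).mpr hz)
    (fun z hz => (hlat₂ z).mpr hz) hmem.2.1 (hmem.2.2.1 ▸ hmem.2.1)
  have hcomm : Matrix.diagonal d * Matrix.diagonal ![γ₁, γ₂] =
      Matrix.diagonal ![γ₁, γ₂] * Matrix.diagonal d := by
    rw [Matrix.diagonal_mul_diagonal, Matrix.diagonal_mul_diagonal]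
    simp only [mul_comm]
  refine ⟨⟨LinearEquiv.ofBijective
    (((Matrix.diagonal d).mulVecLin.restrictScalars ℚ).restrict fun z hz => (hdiag z).mpr hz)
    ⟨?_, ?_⟩, fun x y hxy => ?_⟩, hd.unit, hcomm, ?_, exists_isogeny_of_rationalSpan hd hdiag⟩
  · rintro ⟨x, hx⟩ ⟨y, hy⟩ hxy
    exact Subtype.ext ((mulVec_bijective hd).1 (congrArg Subtype.val hxy))
  · rintro ⟨y, hy⟩
    obtain ⟨x, rfl⟩ := (mulVec_bijective hd).2 y
    exact ⟨⟨x, (hdiag x).mp hy⟩, rfl⟩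
  · show (Matrix.diagonal d).mulVec y = (Matrix.diagonal ![γ₁, γ₂]).mulVec
      ((Matrix.diagonal d).mulVec x)
    rw [hxy, Matrix.mulVec_mulVec, Matrix.mulVec_mulVec, hcomm]
  · ext w
    obtain ⟨z, rfl⟩ := (mulVec_bijective hd).2 w
    rw [SetLike.mem_coe, hdiag]
    exact (mulVec_bijective hd).1.mem_set_image

end ComplexTorus

/-! ### The infinite family of tori in the square case. -/

namespace ComplexTorus

variable {X Y : ComplexTorus}

theorem mem_gaussianSquare_lattice {k : ℕ} {z : Fin 2 → ℂ} :
    z ∈ (gaussianSquare k).lattice ↔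
      ∀ j, ∃ a b : ℤ, z j = a + b * ((2 : ℂ) ^ k * Complex.I) := by
  have hlat : (gaussianSquare k).lattice =
      Submodule.span ℤ (⋃ j : Fin 2, {Pi.single j 1, Pi.single j ((2 : ℂ) ^ k * Complex.I)}) := by
    rw [← range_gaussianBasis]; rfl
  rw [hlat]
  constructor
  · intro h
    induction h using Submodule.span_induction with
    | mem x hx =>
      intro i
      simp only [Set.mem_iUnion, Set.mem_insert_iff, Set.mem_singleton_iff] at hx
      obtain ⟨j, rfl | rfl⟩ := hx
      · by_cases h : i = j
        · subst h; exact ⟨1, 0, by simp⟩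
        · exact ⟨0, 0, by simp [h]⟩
      · by_cases h : i = j
        · subst h; exact ⟨0, 1, by simp⟩
        · exact ⟨0, 0, by simp [h]⟩
    | zero => exact fun j => ⟨0, 0, by simp⟩
    | add x y _ _ hx hy =>
      intro j
      obtain ⟨a, b, h⟩ := hx j
      obtain ⟨c, d, h'⟩ := hy j
      exact ⟨a + c, b + d, by rw [Pi.add_apply, h, h']; push_cast; ring⟩
    | smul n x _ hx =>
      intro j
      obtain ⟨a, b, h⟩ := hx j
      exact ⟨n * a, n * b, by rw [Pi.smul_apply, h, zsmul_eq_mul]; push_cast; ring⟩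
  · intro h
    choose a b hz using h
    have : z = ∑ j, (a j • Pi.single j (1 : ℂ) +
        b j • Pi.single j ((2 : ℂ) ^ k * Complex.I)) := by
      ext i
      rw [hz i]
      fin_cases i <;> simp [Fin.sum_univ_two]
    rw [this]
    refine Submodule.sum_mem _ fun j _ => Submodule.add_mem _ (Submodule.smul_mem _ _ ?_)
      (Submodule.smul_mem _ _ ?_)
    · exact Submodule.subset_span (Set.mem_iUnion.mpr ⟨j, by simp⟩)
    · exact Submodule.subset_span (Set.mem_iUnion.mpr ⟨j, by simp⟩)

theorem mulVec_mem_gaussianSquare_lattice {k : ℕ} (M : Matrix (Fin 2) (Fin 2) ℤ) {z : Fin 2 → ℂ}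
    (hz : z ∈ (gaussianSquare k).lattice) :
    (M.map (Int.cast : ℤ → ℂ)).mulVec z ∈ (gaussianSquare k).lattice := by
  have : (M.map (Int.cast : ℤ → ℂ)).mulVec z = fun i => (M i 0 : ℂ) * z 0 + (M i 1 : ℂ) * z 1 := by
    ext i
    simp [Matrix.mulVec, dotProduct, Fin.sum_univ_two]
  rw [this]
  rw [mem_gaussianSquare_lattice] at hz ⊢
  obtain ⟨a, b, h⟩ := hz 0
  obtain ⟨c, d, h'⟩ := hz 1
  intro i
  exact ⟨M i 0 * a + M i 1 * c, M i 0 * b + M i 1 * d, by simp only [h, h']; push_cast; ring⟩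

/-- Inverse matrices preserving the lattice define an automorphism. -/
theorem exists_automorphism {A B : Matrix (Fin 2) (Fin 2) ℂ} (hAB : A * B = 1)
    (hA : ∀ z ∈ X.lattice, A.mulVec z ∈ X.lattice) (hB : ∀ z ∈ X.lattice, B.mulVec z ∈ X.lattice) :
    ∃ f : X.Carrier ≃ X.Carrier, IsBiholomorphic f ∧ ∀ z, f (X.proj z) = X.proj (A.mulVec z) := by
  have hBA : B * A = 1 := mul_eq_one_comm.mp hAB
  let g : X.Carrier →ₗ[ℤ] X.Carrier := X.lattice.mapQ X.lattice (mulVecInt A) hA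
  let h : X.Carrier →ₗ[ℤ] X.Carrier := X.lattice.mapQ X.lattice (mulVecInt B) hB
  have hg : ∀ z, g (X.proj z) = X.proj (A.mulVec z) := fun _ => rfl
  have hh : ∀ z, h (X.proj z) = X.proj (B.mulVec z) := fun _ => rfl
  refine ⟨⟨g, h, fun x => ?_, fun x => ?_⟩, ⟨?_, ?_⟩, hg⟩
  · obtain ⟨z, rfl⟩ := proj_surjective x
    rw [hg, hh, Matrix.mulVec_mulVec, hBA, Matrix.one_mulVec]
  · obtain ⟨z, rfl⟩ := proj_surjective x
    rw [hh, hg, Matrix.mulVec_mulVec, hAB, Matrix.one_mulVec]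
  · exact isHolomorphic_of_affine (A := A) (b := 0) fun z => by rw [add_zero]; exact hg z
  · exact isHolomorphic_of_affine (A := B) (b := 0) fun z => by rw [add_zero]; exact hh z

/-- An integral matrix acts on every E × E. The companion matrix of t² − kt + ε has determinant ε =
±1 and eigenvalues √λ and ε / √λ. -/
theorem admitsEntropy_gaussianSquare_of_trace {lam : ℝ} (hlam : 1 < lam) {k ε : ℤ}
    (hε : ε * ε = 1) (hk : (k : ℝ) = √lam + ε / √lam) (n : ℕ) :
    (gaussianSquare n).AdmitsEntropy (Real.log lam) := by
  let M : Matrix (Fin 2) (Fin 2) ℤ := !![0, -ε; 1, k]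
  let N : Matrix (Fin 2) (Fin 2) ℤ := !![ε * k, 1; -ε, 0]
  have hMN : M * N = 1 := by
    ext i j
    fin_cases i <;> fin_cases j <;> simp [M, N, Matrix.mul_apply, Fin.sum_univ_two, hε]; ring
  have hMN' : M.map (Int.cast : ℤ → ℂ) * N.map (Int.cast : ℤ → ℂ) = 1 := by
    have := congrArg (fun A : Matrix (Fin 2) (Fin 2) ℤ => A.map (Int.castRingHom ℂ)) hMN
    rwa [Matrix.map_mul, Matrix.map_one _ (map_zero _) (map_one _)] at this
  obtain ⟨f, hf, hfA⟩ := exists_automorphism (X := gaussianSquare n) hMN'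
    (fun z hz => mulVec_mem_gaussianSquare_lattice M hz)
    (fun z hz => mulVec_mem_gaussianSquare_lattice N hz)
  refine ⟨f, hf, ?_⟩
  have hμ : 1 < √lam := Real.lt_sqrt_of_sq_lt (by simpa using hlam)
  have hμ0 : (√lam : ℂ) ≠ 0 := by
    rw [Complex.ofReal_ne_zero]; positivity
  have hεn : ‖(ε : ℂ)‖ = 1 := by
    have : ‖(ε : ℂ)‖ * ‖(ε : ℂ)‖ = 1 := by rw [← norm_mul]; exact_mod_cast (by simp [hε])
    nlinarith [norm_nonneg (ε : ℂ)]
  have hnμ : ‖(√lam : ℂ)‖ = √lam := by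
    rw [Complex.norm_real, Real.norm_of_nonneg (Real.sqrt_nonneg _)]
  rw [coverEntropy_eq (A := M.map Int.cast) (b := 0) (γ₁ := (√lam : ℂ)) (γ₂ := (ε : ℂ) / √lam)
    (fun z => by rw [add_zero, hfA]) ?_ ?_ ?_ ?_, hnμ, Real.sq_sqrt (by linarith)]
  · have : (k : ℂ) = √lam + ε / √lam := by exact_mod_cast congrArg Complex.ofReal hk
    rw [Matrix.trace_fin_two, ← this]
    simp [M]
  · rw [Matrix.det_fin_two, mul_div_cancel₀ _ hμ0]
    simp [M]
  · rw [norm_div, hεn, hnμ, div_le_iff₀ (by positivity)]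
    nlinarith
  · rw [mul_div_cancel₀ _ hμ0, hεn]

/-- Since λ + λ⁻¹ ± 2 = (√λ ± 1/√λ)², the trace required is |k|. -/
theorem admitsEntropy_gaussianSquare {lam : ℝ} (hlam : 1 < lam)
    (h : ∃ k : ℤ, lam + lam⁻¹ + 2 = (k : ℝ) ^ 2 ∨ lam + lam⁻¹ - 2 = (k : ℝ) ^ 2) (n : ℕ) :
    (gaussianSquare n).AdmitsEntropy (Real.log lam) := by
  obtain ⟨k, hk⟩ := h
  have hμ : 1 < √lam := Real.lt_sqrt_of_sq_lt (by simpa using hlam)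
  have hinv : lam⁻¹ = (1 / √lam) ^ 2 := by
    rw [div_pow, one_pow, Real.sq_sqrt (by linarith), one_div]
  have hlt : 1 / √lam < 1 := by rw [div_lt_one (by positivity)]; exact hμ
  have hpos : 0 < 1 / √lam := by positivity
  have hprod : √lam * (1 / √lam) = 1 := by field_simp
  have hsq : √lam ^ 2 = lam := Real.sq_sqrt (by linarith)
  rcases hk with hk | hk
  · refine admitsEntropy_gaussianSquare_of_trace hlam (k := |k|) (ε := 1) rfl ?_ n
    have : ((|k| : ℤ) : ℝ) ^ 2 = (√lam + 1 / √lam) ^ 2 := by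
      rw [Int.cast_abs, sq_abs, ← hk, hinv]
      linear_combination -hsq - 2 * hprod
    rw [pow_left_inj₀ (by positivity) (by positivity) two_ne_zero] at this
    simpa using this
  · refine admitsEntropy_gaussianSquare_of_trace hlam (k := |k|) (ε := -1) rfl ?_ n
    have : ((|k| : ℤ) : ℝ) ^ 2 = (√lam - 1 / √lam) ^ 2 := by
      rw [Int.cast_abs, sq_abs, ← hk, hinv]
      linear_combination -hsq + 2 * hprod
    rw [pow_left_inj₀ (by positivity) (by linarith) two_ne_zero] at this
    rw [this]; push_cast; ring

theorem isBiholomorphic_refl (X : ComplexTorus) : IsBiholomorphic (Equiv.refl X.Carrier) :=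
  ⟨isHolomorphic_of_affine (A := 1) (b := 0) fun z => by simp,
    isHolomorphic_of_affine (A := 1) (b := 0) fun z => by simp⟩

/-- The scalar 2^k i preserves the source lattice and commutes with the complex-linear part of f, so
it maps the first unit vector into the target lattice. Thus 2^k i lies in ℤ[2^l i], and 2^l divides
2^k. -/
theorem le_of_isBiholomorphic_gaussianSquare {k l : ℕ}
    {f : (gaussianSquare k).Carrier ≃ (gaussianSquare l).Carrier} (hf : IsBiholomorphic f) :
    l ≤ k := by
  obtain ⟨A, b, -, hA, hlat⟩ := hf.exists_affine
  have h1 : (Pi.single 0 1 : Fin 2 → ℂ) ∈ (gaussianSquare l).lattice := by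
    rw [mem_gaussianSquare_lattice]
    intro j
    fin_cases j
    · exact ⟨1, 0, by simp⟩
    · exact ⟨0, 0, by simp⟩
  obtain ⟨w, hw⟩ := (mulVec_bijective hA).2 (Pi.single 0 1)
  rw [← hw, hlat] at h1
  have h2 : ((2 : ℂ) ^ k * Complex.I) • w ∈ (gaussianSquare k).lattice := by
    rw [mem_gaussianSquare_lattice] at h1 ⊢
    intro j
    obtain ⟨c, d, h⟩ := h1 j
    refine ⟨-(4 ^ k * d), c, ?_⟩
    rw [Pi.smul_apply, h, smul_eq_mul]
    have h4 : (4 : ℂ) ^ k = 2 ^ k * 2 ^ k := by rw [← mul_pow]; norm_num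
    push_cast
    rw [h4]
    linear_combination (2 : ℂ) ^ k * 2 ^ k * d * Complex.I_mul_I
  rw [← hlat, Matrix.mulVec_smul, hw, mem_gaussianSquare_lattice] at h2
  obtain ⟨c, d, h⟩ := h2 0
  have h3 := congrArg Complex.im h
  have e : ∀ m : ℕ, ((2 : ℂ) ^ m).re = 2 ^ m ∧ ((2 : ℂ) ^ m).im = 0 := fun m => by
    have : ((2 : ℂ) ^ m) = ((2 ^ m : ℝ) : ℂ) := by push_cast; rfl
    rw [this]; exact ⟨Complex.ofReal_re _, Complex.ofReal_im _⟩
  simp [(e k).1, (e k).2, (e l).1, (e l).2] at h3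
  have h5 : (2 : ℤ) ^ k = d * 2 ^ l := by exact_mod_cast h3
  have h6 : (2 : ℤ) ^ l ∣ 2 ^ k := ⟨d, by rw [h5]; ring⟩
  have h7 : (2 : ℕ) ^ l ∣ 2 ^ k := by exact_mod_cast h6
  exact (Nat.pow_dvd_pow_iff_le_right (by norm_num)).mp h7

theorem isomorphismClass_gaussianSquare_injective :
    Function.Injective fun k => isomorphismClass (gaussianSquare k) := by
  have key : ∀ k l, isomorphismClass (gaussianSquare k) = isomorphismClass (gaussianSquare l) →
      l ≤ k := by
    intro k l h
    have : gaussianSquare l ∈ isomorphismClass (gaussianSquare k) := by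
      rw [h]; exact ⟨_, isBiholomorphic_refl _⟩
    obtain ⟨f, hf⟩ := this
    exact le_of_isBiholomorphic_gaussianSquare hf
  exact fun k l h => le_antisymm (key l k h.symm) (key k l h)

/-- If `lam + lam⁻¹ ± 2` is a square, there are infinitely many tori with an automorphism of entropy
`log lam`. -/
theorem infinite_isomorphismClass {lam : ℝ} (hlam : 1 < lam)
    (h : ∃ k : ℤ, lam + lam⁻¹ + 2 = (k : ℝ) ^ 2 ∨ lam + lam⁻¹ - 2 = (k : ℝ) ^ 2) :
    (isomorphismClass '' {X | X.AdmitsEntropy (Real.log lam)}).Infinite :=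
  Set.infinite_of_injective_forall_mem isomorphismClass_gaussianSquare_injective
    fun n => ⟨gaussianSquare n, admitsEntropy_gaussianSquare hlam h n, rfl⟩

end ComplexTorus

/-! ### Counting the eigenvalue pairs. -/

/-- The possible values of the trace and norm of the part of the action on the second exterior power
with eigenvalues on the unit circle, where `s = lam + lam⁻¹`. -/
def circlePairs (s : ℝ) : Set (ℝ × ℝ) :=
  {v | (∃ a b c : ℤ, (a : ℝ) = s + v.1 ∧ (b : ℝ) = v.2 + s * v.1 ∧ (c : ℝ) = s * v.2) ∧
    0 ≤ 4 - 2 * v.1 + v.2 ∧ 0 ≤ 4 + 2 * v.1 + v.2 ∧ 4 * v.2 ≤ v.1 ^ 2 ∧ v.1 ^ 2 ≤ 16}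

theorem exists_int_of_isIntegral_of_rat {s : ℝ} (hs : IsIntegral ℤ s) {r : ℚ} (hr : (r : ℝ) = s) :
    ∃ n : ℤ, s = n := by
  have h1 : IsIntegral ℤ r := by
    have : IsIntegral ℤ (algebraMap ℚ ℝ r) := by rw [eq_ratCast, hr]; exact hs
    exact (isIntegral_algebraMap_iff (algebraMap ℚ ℝ).injective).mp this
  obtain ⟨n, hn⟩ := IsIntegrallyClosed.isIntegral_iff.mp h1
  exact ⟨n, by rw [← hr, ← hn]; simp⟩

/-- If s is an integer, so are p and q, and a search over |p|, |q| ≤ 4 finds at most 20. Otherwise a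
= s + p takes at most nine values, and it determines both p and q. -/
theorem encard_circlePairs_le (s : ℝ) : (circlePairs s).encard ≤ 20 := by
  by_cases hs : ∃ n : ℤ, s = n
  · obtain ⟨n, rfl⟩ := hs
    let F : Finset (ℤ × ℤ) := (Finset.Icc (-4) 4 ×ˢ Finset.Icc (-4) 4).filter fun v =>
      0 ≤ 4 - 2 * v.1 + v.2 ∧ 0 ≤ 4 + 2 * v.1 + v.2 ∧ 4 * v.2 ≤ v.1 ^ 2
    have hF : F.card ≤ 20 := by decide +kernel
    have hsub : circlePairs n ⊆ (fun v : ℤ × ℤ => ((v.1 : ℝ), (v.2 : ℝ))) '' (F : Set (ℤ × ℤ)) := by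
      rintro ⟨p, q⟩ ⟨⟨a, b, c, ha, hb, hc⟩, h1, h2, h3, h4⟩
      simp only at ha hb hc h1 h2 h3 h4
      have hp : p = ((a - n : ℤ) : ℝ) := by push_cast; linarith
      have hq : q = ((b - n * (a - n) : ℤ) : ℝ) := by
        push_cast; rw [hp] at hb; push_cast at hb; linarith
      generalize a - n = p' at hp hq
      generalize b - n * p' = q' at hq
      subst hp hq
      have h1 : 0 ≤ 4 - 2 * p' + q' := by exact_mod_cast h1
      have h2 : 0 ≤ 4 + 2 * p' + q' := by exact_mod_cast h2
      have h3 : 4 * q' ≤ p' ^ 2 := by exact_mod_cast h3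
      have h4 : p' ^ 2 ≤ 16 := by exact_mod_cast h4
      have h5 : |p'| ≤ 4 := abs_le_of_sq_le_sq (by linarith) (by norm_num)
      rw [abs_le] at h5
      refine ⟨(p', q'), ?_, rfl⟩
      simp only [F, Finset.coe_filter, Finset.mem_product, Finset.mem_Icc, Set.mem_ofPred_eq]
      exact ⟨⟨h5, by omega, by omega⟩, h1, h2, h3⟩
    refine (Set.encard_le_encard hsub).trans ((Set.encard_image_le _ _).trans ?_)
    rw [Set.encard_coe_eq_coe_finsetCard]
    exact_mod_cast hF
  · have hinj : Set.InjOn (fun v : ℝ × ℝ => ⌊s + v.1⌋) (circlePairs s) := by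
      rintro ⟨p, q⟩ ⟨⟨a, b, c, ha, hb, hc⟩, -⟩ ⟨p', q'⟩ ⟨⟨a', b', c', ha', hb', hc'⟩, -⟩ h
      simp only at ha hb hc ha' hb' hc' h
      rw [← ha, ← ha', Int.floor_intCast, Int.floor_intCast] at h
      subst h
      have hpp : p = p' := by linarith
      subst hpp
      -- For equal p, b − b' = q − q' and c − c' = s(q − q'), so b ≠ b' would make s rational. As a
      -- root of X³ − aX² + bX − c, it would then be an integer.
      have hbb : b = b' := by
        by_contra hne
        have hne' : (b : ℝ) - b' ≠ 0 := sub_ne_zero.mpr (by exact_mod_cast hne)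
        apply hs
        refine exists_int_of_isIntegral_of_rat (r := ((c - c' : ℤ) : ℚ) / ((b - b' : ℤ) : ℚ)) ?_ ?_
        · refine ⟨.X ^ 3 + (-.C a * .X ^ 2 + .C b * .X - .C c), ?_, ?_⟩
          · refine Polynomial.monic_X_pow_add
              ((Polynomial.degree_lt_iff_coeff_zero _ 3).mpr fun m hm => ?_)
            simp only [← Polynomial.C_neg, Polynomial.coeff_add, Polynomial.coeff_sub,
              Polynomial.coeff_C_mul, Polynomial.coeff_X_pow, Polynomial.coeff_X,
              Polynomial.coeff_C]
            rw [if_neg (by omega), if_neg (by omega), if_neg (by omega)]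
            simp
          · simp only [Polynomial.eval₂_add, Polynomial.eval₂_sub, Polynomial.eval₂_mul,
              Polynomial.eval₂_pow, Polynomial.eval₂_X, Polynomial.eval₂_neg, Polynomial.eval₂_C]
            simp only [eq_intCast]
            rw [ha, hb, hc]; ring
        · push_cast
          rw [div_eq_iff hne', hb, hb', hc, hc']; ring
      subst hbb
      have : q = q' := by linarith
      rw [this]
    have hmaps : Set.MapsTo (fun v : ℝ × ℝ => ⌊s + v.1⌋) (circlePairs s)
        (Finset.Icc ⌈s - 4⌉ ⌊s + 4⌋ : Finset ℤ) := by
      rintro ⟨p, q⟩ ⟨⟨a, b, c, ha, hb, hc⟩, -, -, -, h4⟩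
      simp only at ha h4
      have h5 : |p| ≤ 4 := abs_le_of_sq_le_sq (by linarith) (by norm_num)
      rw [abs_le] at h5
      simp only [Finset.coe_Icc, Set.mem_Icc]
      rw [← ha, Int.floor_intCast, Int.ceil_le, Int.le_floor, ha]
      constructor <;> linarith
    refine (Set.encard_le_encard_of_injOn hmaps hinj).trans ?_
    rw [Set.encard_coe_eq_coe_finsetCard, Int.card_Icc]
    have h1 := Int.floor_le (s + 4)
    have h2 := Int.le_ceil (s - 4)
    have h3 : ⌊s + 4⌋ - ⌈s - 4⌉ ≤ 8 := by
      have : ((⌊s + 4⌋ - ⌈s - 4⌉ : ℤ) : ℝ) ≤ 8 := by push_cast; linarith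
      exact_mod_cast this
    have h4 : (⌊s + 4⌋ + 1 - ⌈s - 4⌉).toNat ≤ 20 := by omega
    exact_mod_cast h4

theorem eq_of_sq_eq_of_nonneg_iff {x y : ℝ} (h : x ^ 2 = y ^ 2) (hs : 0 ≤ x ↔ 0 ≤ y) : x = y := by
  rcases sq_eq_sq_iff_eq_or_eq_neg.mp h with h | h
  · exact h
  · by_cases hy : 0 ≤ y
    · have := hs.mpr hy; linarith
    · have : 0 ≤ x := by linarith
      exact absurd (hs.mp this) hy

/-- λ is one of the six products. Four have absolute value 1 and |γ₂|² < 1, so only γ₁γ̄₁ is left.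
-/
theorem norm_sq_of_mem_eigenvaluePairs {lam : ℝ} (hlam : 1 < lam) {γ : ℂ × ℂ}
    (h : γ ∈ eigenvaluePairs lam) : ‖γ.1‖ ^ 2 = lam ∧ ‖γ.2‖ ^ 2 = lam⁻¹ := by
  obtain ⟨-, -, -, hlt, hone, Q, hQ, hdeg, -, hdvd, hroots, -⟩ := h
  have hone' : ‖γ.1‖ * ‖γ.2‖ = 1 := by rw [← norm_mul, hone]
  have hone'' : ‖γ.2‖ * ‖γ.1‖ = 1 := by rw [mul_comm, hone']
  have hl : (lam : ℂ) ∈ (Q.map (Int.castRingHom ℂ)).roots := by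
    rw [Polynomial.mem_roots (hQ.map _).ne_zero, Polynomial.IsRoot, Polynomial.eval_map]
    have h1 : Polynomial.aeval lam Q = 0 := by
      obtain ⟨R, rfl⟩ := hdvd
      rw [map_mul, minpoly.aeval, zero_mul]
    have h2 := Polynomial.aeval_algebraMap_apply ℂ lam Q
    rw [h1, map_zero] at h2
    exact h2
  have hn : ‖(lam : ℂ)‖ = lam := by rw [Complex.norm_real, Real.norm_of_nonneg (by linarith)]
  have h2 : ‖γ.2‖ < 1 := by nlinarith [norm_nonneg γ.2]
  have hmain : ‖γ.1‖ ^ 2 = lam := by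
    rw [hroots] at hl
    simp only [Multiset.insert_eq_cons, Multiset.mem_cons, Multiset.mem_singleton] at hl
    rcases hl with hl | hl | hl | hl | hl | hl <;> have hl := congrArg norm hl <;>
      rw [hn] at hl <;> simp only [norm_mul, norm_star, hone', hone''] at hl
    · linarith
    · rw [hl, sq]
    · linarith
    · linarith
    · nlinarith [norm_nonneg γ.2]
    · linarith
  refine ⟨hmain, ?_⟩
  rw [← hmain]
  refine eq_inv_of_mul_eq_one_right ?_
  rw [← mul_pow, hone', one_pow]

/-- The two entries are the sum p and the product q of 2 Re(γ₁γ₂) and 2 Re(γ₁γ̄₂), the values of t +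
t⁻¹ at the roots on the circle. The inequalities express that these are real and lie in [−2, 2]. -/
theorem mem_circlePairs {lam : ℝ} (hlam : 1 < lam) {γ : ℂ × ℂ} (h : γ ∈ eigenvaluePairs lam) :
    (4 * (γ.1.re * γ.2.re), 4 * (lam * γ.2.re ^ 2 + lam⁻¹ * γ.1.re ^ 2 - 1)) ∈
      circlePairs (lam + lam⁻¹) := by
  obtain ⟨hγ₁, hγ₂⟩ := norm_sq_of_mem_eigenvaluePairs hlam h
  obtain ⟨-, -, -, -, -, Q, hQ, -, -, -, hroots, -⟩ := h
  obtain ⟨γ₁, γ₂⟩ := γ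
  simp only at *
  have hinv : lam * lam⁻¹ = 1 := mul_inv_cancel₀ (by positivity)
  have hinvpos : 0 < lam⁻¹ := by positivity
  have hs₁ : γ₁ * star γ₁ = lam := by
    rw [← hγ₁, Complex.star_def, Complex.mul_conj']; norm_cast
  have hs₂ : γ₂ * star γ₂ = (lam⁻¹ : ℝ) := by
    rw [← hγ₂, Complex.star_def, Complex.mul_conj']; norm_cast
  have ht₁ : γ₁ + star γ₁ = (2 * γ₁.re : ℝ) := Complex.add_conj γ₁
  have ht₂ : γ₂ + star γ₂ = (2 * γ₂.re : ℝ) := Complex.add_conj γ₂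
  rw [Complex.sq_norm, Complex.normSq_apply] at hγ₁ hγ₂
  have hprod := (IsAlgClosed.splits (Q.map (Int.castRingHom ℂ))).eq_prod_roots_of_monic (hQ.map _)
  rw [hroots, prod_X_sub_C_products γ₁ (star γ₁) γ₂ (star γ₂)] at hprod
  set x := γ₁.re
  set y := γ₂.re
  have e1 : γ₁ + star γ₁ + γ₂ + star γ₂ = (2 * x + 2 * y : ℝ) := by
    rw [add_assoc, ht₁, ht₂]; push_cast; ring
  have e2 : γ₁ * star γ₁ + γ₁ * γ₂ + γ₁ * star γ₂ + star γ₁ * γ₂ + star γ₁ * star γ₂ +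
      γ₂ * star γ₂ = (lam + lam⁻¹ + 4 * (x * y) : ℝ) := by
    have : γ₁ * star γ₁ + γ₁ * γ₂ + γ₁ * star γ₂ + star γ₁ * γ₂ + star γ₁ * star γ₂ +
      γ₂ * star γ₂ = γ₁ * star γ₁ + γ₂ * star γ₂ + (γ₁ + star γ₁) * (γ₂ + star γ₂) := by ring
    rw [this, hs₁, hs₂, ht₁, ht₂]; push_cast; ring
  have e3 : γ₁ * star γ₁ * γ₂ + γ₁ * star γ₁ * star γ₂ + γ₁ * γ₂ * star γ₂ +
      star γ₁ * γ₂ * star γ₂ = (2 * lam * y + 2 * lam⁻¹ * x : ℝ) := by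
    have : γ₁ * star γ₁ * γ₂ + γ₁ * star γ₁ * star γ₂ + γ₁ * γ₂ * star γ₂ +
      star γ₁ * γ₂ * star γ₂ =
        γ₁ * star γ₁ * (γ₂ + star γ₂) + γ₂ * star γ₂ * (γ₁ + star γ₁) := by ring
    rw [this, hs₁, hs₂, ht₁, ht₂]; push_cast; ring
  have e4 : γ₁ * star γ₁ * γ₂ * star γ₂ = (1 : ℝ) := by
    rw [mul_assoc, hs₁, hs₂, ← Complex.ofReal_mul, hinv]
  rw [e1, e2, e3, e4] at hprod
  have hcoeff : ∀ n, (((Q.coeff n : ℤ) : ℝ) : ℂ) = (Q.map (Int.castRingHom ℂ)).coeff n := fun n => by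
    rw [Polynomial.coeff_map]; push_cast; rfl
  have c5 : ((Q.coeff 5 : ℤ) : ℝ) = -(lam + lam⁻¹ + 4 * (x * y)) := by
    apply Complex.ofReal_injective
    rw [hcoeff, hprod]
    simp only [Polynomial.coeff_add, Polynomial.coeff_sub, Polynomial.coeff_C_mul,
      Polynomial.coeff_X_pow, Polynomial.coeff_X, Polynomial.coeff_C]
    norm_num
  have c4 : ((Q.coeff 4 : ℤ) : ℝ) = (2 * x + 2 * y) * (2 * lam * y + 2 * lam⁻¹ * x) - 1 := by
    apply Complex.ofReal_injective
    rw [hcoeff, hprod]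
    simp only [Polynomial.coeff_add, Polynomial.coeff_sub, Polynomial.coeff_C_mul,
      Polynomial.coeff_X_pow, Polynomial.coeff_X, Polynomial.coeff_C]
    norm_num
  have c3 : ((Q.coeff 3 : ℤ) : ℝ) = -((2 * x + 2 * y) ^ 2 + (2 * lam * y + 2 * lam⁻¹ * x) ^ 2 -
      2 * (lam + lam⁻¹ + 4 * (x * y))) := by
    apply Complex.ofReal_injective
    rw [hcoeff, hprod]
    simp only [Polynomial.coeff_add, Polynomial.coeff_sub, Polynomial.coeff_C_mul,
      Polynomial.coeff_X_pow, Polynomial.coeff_X, Polynomial.coeff_C]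
    norm_num
  -- With cᵢ the coefficients of the reciprocal Q, t⁻³Q(t) = u³ + c₅u² + (c₄ − 3)u + (c₃ − 2c₅) for
  -- u = t + t⁻¹; the witnesses are its coefficients up to sign.
  refine ⟨⟨-Q.coeff 5, Q.coeff 4 - 3, -Q.coeff 3 + 2 * Q.coeff 5, ?_, ?_, ?_⟩, ?_, ?_, ?_, ?_⟩
  · push_cast; rw [c5]; ring
  · push_cast; rw [c4]; ring
  · push_cast; rw [c5, c3]
    linear_combination (8 * x * y - 4 * x ^ 2 - 4 * y ^ 2) * hinv
  · have : 4 - 2 * (4 * (x * y)) + 4 * (lam * y ^ 2 + lam⁻¹ * x ^ 2 - 1) =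
      4 * lam * (y - lam⁻¹ * x) ^ 2 := by linear_combination (8 * x * y - 4 * x ^ 2 * lam⁻¹) * hinv
    rw [this]; positivity
  · have : 4 + 2 * (4 * (x * y)) + 4 * (lam * y ^ 2 + lam⁻¹ * x ^ 2 - 1) =
      4 * lam * (y + lam⁻¹ * x) ^ 2 := by linear_combination (-(8 * x * y) - 4 * x ^ 2 * lam⁻¹) * hinv
    rw [this]; positivity
  · have : (4 * (x * y)) ^ 2 - 4 * (4 * (lam * y ^ 2 + lam⁻¹ * x ^ 2 - 1)) =
      16 * (lam⁻¹ - y ^ 2) * (lam - x ^ 2) := by linear_combination (-16 : ℝ) * hinv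
    have h1 : 0 ≤ (lam⁻¹ - y ^ 2) * (lam - x ^ 2) :=
      mul_nonneg (by nlinarith [sq_nonneg γ₂.im]) (by nlinarith [sq_nonneg γ₁.im])
    nlinarith
  · have h1 : x ^ 2 ≤ lam := by nlinarith [sq_nonneg γ₁.im]
    have h2 : y ^ 2 ≤ lam⁻¹ := by nlinarith [sq_nonneg γ₂.im]
    have h3 : x ^ 2 * y ^ 2 ≤ lam * lam⁻¹ := by gcongr
    nlinarith

/-- Let x, y be the real parts. Then p and q determine (λy + x)² and (λy − x)², and the known
absolute values determine the squares of the imaginary parts. Four signs remain, a factor of 16. -/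
theorem encard_eigenvaluePairs_le {lam : ℝ} (hlam : 1 < lam) :
    (eigenvaluePairs lam).encard ≤ 320 := by
  classical
  let Ψ : ℂ × ℂ → (ℝ × ℝ) × (Bool × Bool × Bool × Bool) := fun γ =>
    ((4 * (γ.1.re * γ.2.re), 4 * (lam * γ.2.re ^ 2 + lam⁻¹ * γ.1.re ^ 2 - 1)),
      (decide (0 ≤ lam * γ.2.re + γ.1.re), decide (0 ≤ lam * γ.2.re - γ.1.re),
        decide (0 ≤ γ.1.im), decide (0 ≤ γ.2.im)))
  have hinv : lam * lam⁻¹ = 1 := mul_inv_cancel₀ (by positivity)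
  have hinj : Set.InjOn Ψ (eigenvaluePairs lam) := by
    rintro ⟨γ₁, γ₂⟩ h ⟨δ₁, δ₂⟩ h' heq
    obtain ⟨h1, h2⟩ := norm_sq_of_mem_eigenvaluePairs hlam h
    obtain ⟨h1', h2'⟩ := norm_sq_of_mem_eigenvaluePairs hlam h'
    simp only [Ψ, Prod.mk.injEq, decide_eq_decide] at heq
    simp only [Complex.sq_norm, Complex.normSq_apply] at h1 h2 h1' h2'
    obtain ⟨⟨hp, hq⟩, s1, s2, s3, s4⟩ := heq
    have a1 := eq_of_sq_eq_of_nonneg_iff (by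
      linear_combination (lam / 2) * hp + (lam / 4) * hq +
        (δ₁.re ^ 2 - γ₁.re ^ 2) * hinv) s1
    have a2 := eq_of_sq_eq_of_nonneg_iff (by
      linear_combination -(lam / 2) * hp + (lam / 4) * hq +
        (δ₁.re ^ 2 - γ₁.re ^ 2) * hinv) s2
    have hx : γ₁.re = δ₁.re := by linarith
    have hy : γ₂.re = δ₂.re := by
      have : lam * γ₂.re = lam * δ₂.re := by linarith
      exact mul_left_cancel₀ (by positivity) this
    rw [← hx] at h1'
    rw [← hy] at h2'
    have b1 := eq_of_sq_eq_of_nonneg_iff (by linear_combination h1 - h1') s3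
    have b2 := eq_of_sq_eq_of_nonneg_iff (by linear_combination h2 - h2') s4
    rw [Complex.ext hx b1, Complex.ext hy b2]
  have hle := encard_circlePairs_le (lam + lam⁻¹)
  have hfin : (circlePairs (lam + lam⁻¹)).Finite :=
    Set.finite_of_encard_le_coe (k := 20) (by exact_mod_cast hle)
  have hcard : hfin.toFinset.card ≤ 20 := by
    rw [hfin.encard_eq_coe_toFinset_card] at hle
    exact_mod_cast hle
  have hmaps : Set.MapsTo Ψ (eigenvaluePairs lam)
      (hfin.toFinset ×ˢ (Finset.univ : Finset (Bool × Bool × Bool × Bool)) : Finset _) := by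
    intro γ hγ
    simp only [Finset.coe_product, Set.mem_prod, Finset.coe_univ, Set.mem_univ, and_true,
      Set.Finite.coe_toFinset]
    exact mem_circlePairs hlam hγ
  refine (Set.encard_le_encard_of_injOn hmaps hinj).trans ?_
  rw [Set.encard_coe_eq_coe_finsetCard, Finset.card_product]
  have : (Finset.univ : Finset (Bool × Bool × Bool × Bool)).card = 16 := rfl
  rw [this]
  exact_mod_cast (by omega : hfin.toFinset.card * 16 ≤ 320)

/-! ### The main theorem. -/

theorem mainTheorem6 :
    (∀ k l : ℕ,
      ComplexTorus.Isogenous (ComplexTorus.gaussianSquare k) (ComplexTorus.gaussianSquare l)) ∧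
    ∀ lam : ℝ, IsSalemNumber lam →
      (∃ X : ComplexTorus, X.AdmitsEntropy (Real.log lam)) →
      ((ComplexTorus.isomorphismClass '' {X | X.AdmitsEntropy (Real.log lam)}).Finite ∨
        ¬ ∃ k : ℤ, lam + lam⁻¹ + 2 = (k : ℝ) ^ 2 ∨ lam + lam⁻¹ - 2 = (k : ℝ) ^ 2) →
      (ComplexTorus.isogenyClass '' {X | X.AdmitsEntropy (Real.log lam)}).encard ≤ 320 ∧
      (ComplexTorus.isogenyClass '' {X | X.AdmitsEntropy (Real.log lam)}).encard ≤
        (eigenvaluePairs lam).encard ∧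
      (eigenvaluePairs lam).encard ≤ 320 ∧
      ∀ (γ₁ γ₂ : ℂ) (G : Matrix (Fin 2) (Fin 2) ℂ), G = Matrix.diagonal ![γ₁, γ₂] →
        ‖γ₁‖ ^ 2 = lam →
        ∀ X₁ X₂ : ComplexTorus,
          (fun z => G.mulVec z) '' (X₁.lattice : Set (Fin 2 → ℂ)) = X₁.lattice →
          (fun z => G.mulVec z) '' (X₂.lattice : Set (Fin 2 → ℂ)) = X₂.lattice →
          (∃ B : X₁.rationalSpan ≃ₗ[ℚ] X₂.rationalSpan, ∀ x y : X₁.rationalSpan,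
            (y : Fin 2 → ℂ) = G.mulVec x → (B y : Fin 2 → ℂ) = G.mulVec (B x)) ∧
          ∃ Φ : GL (Fin 2) ℂ, Φ.val * G = G * Φ.val ∧
            (fun z => Φ.val.mulVec z) '' (X₁.rationalSpan : Set (Fin 2 → ℂ)) = X₂.rationalSpan ∧
            ∃ (n : ℤ) (f : X₁.Carrier →+ X₂.Carrier), n ≠ 0 ∧ ComplexTorus.IsIsogeny f ∧
              ∀ z, f (X₁.proj z) = X₂.proj (n • Φ.val.mulVec z) := by
  refine ⟨ComplexTorus.isogenous_gaussianSquare, fun lam hS _ hfin => ?_⟩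
  have hlam : 1 < lam := hS.1
  have hsq : ¬ ∃ k : ℤ, lam + lam⁻¹ + 2 = (k : ℝ) ^ 2 ∨ lam + lam⁻¹ - 2 = (k : ℝ) ^ 2 := by
    rcases hfin with h | h
    · exact fun hk => ComplexTorus.infinite_isomorphismClass hlam hk h
    · exact h
  have h1 := ComplexTorus.encard_isogenyClass_le hlam hsq
  have h2 := encard_eigenvaluePairs_le hlam
  exact ⟨h1.trans h2, h1, h2, ComplexTorus.exists_isogeny_commuting hlam hsq⟩
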